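/- Let $S$ be a closed oriented surface of negative Euler characteristic (equivalently, a closed oriented surface carrying a hyperbolic metric), and let $j:\pi_1(S)\to\mathrm{Isom}(\mathbb{H}^2)$ be a Fuchsian (that is, discrete and faithful) representation into the isometry group of the hyperbolic plane. Let $M$ be a complete $\mathrm{CAT}(-1)$ space (a complete geodesic metric space whose triangles are at most as thick as their comparison triangles in $\mathbb{H}^2$), for instance a complete simply connected Riemannian manifold of sectional curvature at most $-1$. Let $\partial_\infty M$ be its boundary at infinity, the set of unit speed geodesic rays modulo bounded distance. For an isometry $g$ of $M$ let $l(g)=\inf_{x\in M}d(x,g\cdot x)$ be its translation length. Let $\rho:\pi_1(S)\to\mathrm{Isom}(M)$ be a parabolic representation, that is, one that fixes a point of $\partial_\infty M$, and let $m:\pi_1(S)\to\mathbb{R}$ be a homomorphism such that $$l(\rho(\gamma))=|m(\gamma)|\qquad\text{for all }\gamma\in\pi_1(S).$$ Let $\mathrm{Lip}(j,\rho)$ be the infimum of the constants $\lambda\ge 0$ for which there is a $\lambda$-Lipschitz map $f:\mathbb{H}^2\to M$ with $f(j(\gamma)\cdot x)=\rho(\gamma)\cdot f(x)$ for all $\gamma\in\pi_1(S)$,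 $x\in\mathbb{H}^2$, and let $\mathrm{Lip}(j,m)$ be the infimum of the constants $\lambda\ge 0$ for which there is a $\lambda$-Lipschitz function $f:\mathbb{H}^2\to\mathbb{R}$ with $f(j(\gamma)\cdot x)=f(x)+m(\gamma)$ for all $\gamma\in\pi_1(S)$, $x\in\mathbb{H}^2$. Then both are finite and $$\mathrm{Lip}(j,\rho)=\mathrm{Lip}(j,m).$$ -/

import Mathlib

open scoped NNReal ENNReal UpperHalfPlane MatrixGroups

namespace Parabolic

/-! ### Surfaces and Fuchsian representations -/

/-- `S` is a closed oriented surface of negative Euler characteristic, i.e. a closed oriented surface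
carrying a hyperbolic metric: `S` is compact Hausdorff and is the quotient of the hyperbolic plane
`ℍ` by a group of orientation preserving isometries whose quotient map is a covering. -/
structure IsClosedHyperbolicSurface (S : Type*) [TopologicalSpace S] : Prop where
  compact : CompactSpace S
  hausdorff : T2Space S
  uniformization : ∃ p : ℍ → S, IsCoveringMap p ∧ Function.Surjective p ∧
    ∀ z w : ℍ, p z = p w → ∃ A : SL(2, ℝ), A • z = w ∧ ∀ u : ℍ, p (A • u) = p u

/-- A representation into `Isom(ℍ)` is Fuchsian if it is faithful and discrete. On isometries the
topology of pointwise convergence is the usual (compact-open) topology of `Isom(ℍ)`. -/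
structure IsFuchsian {Γ : Type*} [Group Γ] (j : Γ →* (ℍ ≃ᵢ ℍ)) : Prop where
  faithful : Function.Injective j
  discrete : DiscreteTopology (Set.range fun γ : Γ => (j γ : ℍ → ℍ))

/-! ### Complete `CAT(-1)` spaces -/

/-- `c`, restricted to `[0, dist x y]`, is a geodesic segment from `x` to `y`, parametrized by
arc length. -/
structure IsGeodesicSegment {X : Type*} [MetricSpace X] (c : ℝ → X) (x y : X) : Prop where
  source : c 0 = x
  target : c (dist x y) = y
  isometric : ∀ s ∈ Set.Icc 0 (dist x y), ∀ t ∈ Set.Icc 0 (dist x y),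
    dist (c s) (c t) = |s - t|

/-- A `CAT(-1)` space: a geodesic metric space in which triangles are at most as thick as the
comparison triangles in `ℍ`. Two points on different edges of a triangle lie on the two edges issued
from a common vertex, here called `x`; on a single edge the comparison map is isometric. -/
structure IsCATNegOne (M : Type*) [MetricSpace M] : Prop where
  geodesic : ∀ x y : M, ∃ c : ℝ → M, IsGeodesicSegment c x y
  comparison : ∀ (x y z : M) (x' y' z' : ℍ),
    dist x' y' = dist x y → dist x' z' = dist x z → dist y' z' = dist y z →
    ∀ (c₁ c₂ : ℝ → M) (c₁' c₂' : ℝ → ℍ),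
      IsGeodesicSegment c₁ x y → IsGeodesicSegment c₂ x z →
      IsGeodesicSegment c₁' x' y' → IsGeodesicSegment c₂' x' z' →
      ∀ s ∈ Set.Icc 0 (dist x y), ∀ t ∈ Set.Icc 0 (dist x z),
        dist (c₁ s) (c₂ t) ≤ dist (c₁' s) (c₂' t)

/-! ### The boundary at infinity -/

/-- Geodesic rays with unit speed. -/
def GeodesicRay (M : Type*) [MetricSpace M] : Type _ := {c : ℝ≥0 → M // Isometry c}

/-- Two rays are asymptotic if they stay at bounded distance from each other. -/
def asymptotic (M : Type*) [MetricSpace M] : Setoid (GeodesicRay M) where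
  r c c' := ∃ C : ℝ, ∀ t : ℝ≥0, dist (c.1 t) (c'.1 t) ≤ C
  iseqv :=
    { refl := fun c => ⟨0, fun t => by simp⟩
      symm := fun {c c'} ⟨C, h⟩ => ⟨C, fun t => by rw [dist_comm]; exact h t⟩
      trans := fun {c c' c''} ⟨C, h⟩ ⟨C', h'⟩ =>
        ⟨C + C', fun t => (dist_triangle _ (c'.1 t) _).trans (add_le_add (h t) (h' t))⟩ }

/-- The boundary at infinity `∂_∞ M`. -/
def Boundary (M : Type*) [MetricSpace M] : Type _ := Quotient (asymptotic M)

/-- The image of a geodesic ray under an isometry. -/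
def mapRay {M : Type*} [MetricSpace M] (g : M ≃ᵢ M) (c : GeodesicRay M) : GeodesicRay M :=
  ⟨g ∘ c.1, g.isometry.comp c.2⟩

/-- The action of an isometry on the boundary at infinity. -/
def boundaryMap {M : Type*} [MetricSpace M] (g : M ≃ᵢ M) : Boundary M → Boundary M :=
  Quotient.map (mapRay g) (fun _ _ ⟨C, h⟩ => ⟨C, fun t => (g.dist_eq _ _).trans_le (h t)⟩)

/-- A representation is parabolic if it fixes a point of the boundary at infinity. -/
def IsParabolic {Γ : Type*} [Group Γ] {M : Type*} [MetricSpace M] (ρ : Γ →* (M ≃ᵢ M)) : Prop :=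
  ∃ ξ : Boundary M, ∀ γ : Γ, boundaryMap (ρ γ) ξ = ξ

/-! ### Translation length and minimal Lipschitz constant -/

/-- The translation length `l(g) = inf_x d(x, g x)` of an isometry. -/
noncomputable def translationLength {M : Type*} [MetricSpace M] (g : M ≃ᵢ M) : ℝ :=
  ⨅ x : M, dist x (g x)

/-- The action of `Γ` on `ℝ` by translations given by a morphism `m : Γ → ℝ`. -/
def translationRep {Γ : Type*} [Group Γ] (m : Γ →* Multiplicative ℝ) : Γ →* (ℝ ≃ᵢ ℝ) where
  toFun γ := IsometryEquiv.addLeft (m γ).toAdd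
  map_one' := by ext x; simp
  map_mul' γ δ := by ext x; simp [add_assoc]

/-- `(j, ρ)`-equivariant maps. -/
def IsEquivariant {Γ : Type*} [Group Γ] {X : Type*} [MetricSpace X]
    (j : Γ →* (ℍ ≃ᵢ ℍ)) (ρ : Γ →* (X ≃ᵢ X)) (f : ℍ → X) : Prop :=
  ∀ (γ : Γ) (z : ℍ), f (j γ z) = ρ γ (f z)

/-- The minimal Lipschitz constant of `(j, ρ)`-equivariant maps from `ℍ` to `X`: the infimum of the
real numbers `K ≥ 0` for which there is a `(j, ρ)`-equivariant `K`-Lipschitz map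
(`∞` if there is none). -/
noncomputable def minLip {Γ : Type*} [Group Γ] {X : Type*} [MetricSpace X]
    (j : Γ →* (ℍ ≃ᵢ ℍ)) (ρ : Γ →* (X ≃ᵢ X)) : ℝ≥0∞ :=
  ⨅ (K : ℝ≥0) (_ : ∃ f : ℍ → X, IsEquivariant j ρ f ∧ LipschitzWith K f), (K : ℝ≥0∞)

end Parabolic

namespace Parabolic

open Real

/-! ### The hyperbolic plane -/

/-! Let `b` be the Busemann function of a ray `c` ending at the fixed point ξ. An isometry fixing ξ
changes `b` by an additive constant, so `b (ρ γ x) = b x + μ γ` with `μ` a homomorphism. Pushing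
points towards ξ contracts horospheres exponentially, which gives `l(ρ γ) = |μ γ|`
(`translationLength_eq`). Hence `|μ| = |m|`, so `μ = ±m`, and the sign is immaterial for Lipschitz
constants.

One inequality is immediate: `b` is 1-Lipschitz, so `b ∘ F` is an equivariant function whenever `F`
is an equivariant map. For the other, take a `K`-Lipschitz function `f` equivariant under `μ` and
any equivariant Lipschitz map `f₀` into `M`. The function `b ∘ f₀ - f` is `j`-invariant, hence
bounded. Pushing `f₀ z` towards ξ for the time `b (f₀ z) - f z + const` gives an equivariant map
with Busemann function `f - const`. By `IsPush.contraction`, `cosh d - cosh Δb` is multiplied by at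
most `e^{-(s+t)}`, where `s`, `t` are the two pushing times. A large constant therefore leaves only
the variation of `f`, and the map is `(K + ε)`-Lipschitz at small scale, hence globally
(`exists_equivariant_of_function`). All the `CAT(-1)` geometry comes from Stewart's inequality and
its limit at ξ. The map `f₀` is a barycentre, the minimum of a weighted sum of `cosh` of distances
(`exists_equivariant_map`).

Boundedness of invariant functions needs `j` to be cocompact, while only discreteness and
faithfulness are given (`IsFuchsian.isCobounded`). Uniformization of `S` gives a cocompact action
`k` of the same group, which is therefore one-ended. If `j` were not cocompact, an orbit would avoid
a horoball, centred at ∞ after conjugation. A geodesic from ∞ to `γ ∞` cuts the orbit into almost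
invariant pieces, so one-endedness forbids limit points on both sides. This forces the orientation
preserving part of `j` to fix a boundary point. Discreteness makes that group abelian, but an
abelian group cannot act cocompactly through `k`. -/

theorem cosh_dist_eq (z w : ℍ) :
    cosh (dist z w) = ((z.re - w.re) ^ 2 + z.im ^ 2 + w.im ^ 2) / (2 * z.im * w.im) := by
  rw [UpperHalfPlane.cosh_dist']

theorem eq_of_cosh_eq {a b : ℝ} (ha : 0 ≤ a) (hb : 0 ≤ b) (h : cosh a = cosh b) : a = b := by
  have h1 := Real.cosh_le_cosh.1 h.le
  have h2 := Real.cosh_le_cosh.1 h.ge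
  rw [abs_of_nonneg ha, abs_of_nonneg hb] at h1 h2
  exact le_antisymm h1 h2

/-- Divided by `sinh D ^ 2`, this is the unit-norm condition of `exists_combination` for the point
at distance `t` along a segment of length `D`. -/
theorem sinh_sq_add_identity (D t : ℝ) :
    sinh (D - t) ^ 2 + sinh t ^ 2 + 2 * sinh (D - t) * sinh t * cosh D = sinh D ^ 2 := by
  rw [Real.sinh_sub]
  linear_combination sinh D ^ 2 * (Real.cosh_sq t) - sinh t ^ 2 * Real.cosh_sq D

/-- In the hyperboloid model, the combination `α v + β w` of unit vectors is again a unit vector as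
soon as `α² + β² + 2 α β cosh d(v, w) = 1`. -/
theorem exists_combination (v w : ℍ) {α β : ℝ} (hα : 0 ≤ α) (hβ : 0 ≤ β)
    (h : α ^ 2 + β ^ 2 + 2 * α * β * cosh (dist v w) = 1) :
    ∃ g : ℍ, ∀ p : ℍ, cosh (dist p g) = α * cosh (dist p v) + β * cosh (dist p w) := by
  have hv := v.im_pos
  have hw := w.im_pos
  -- A point `p` of the hyperboloid is the binary form with coefficients `1 / im`, `re / im`, `|p|²
  -- / im`, of determinant 1. Here `a`, `b`, `c` are the coefficients of the combination, and the
  -- form comes from the point `(b + i) / a`.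
  set a := α / v.im + β / w.im with ha
  set b := α * v.re / v.im + β * w.re / w.im with hb
  set c := α * (v.re ^ 2 + v.im ^ 2) / v.im + β * (w.re ^ 2 + w.im ^ 2) / w.im with hc
  have ha0 : 0 < a := by
    have h1 : 0 ≤ α / v.im := by positivity
    have h2 : 0 ≤ β / w.im := by positivity
    rcases hα.eq_or_lt with h0 | h0
    · rcases hβ.eq_or_lt with h3 | h3
      · rw [← h0, ← h3] at h; norm_num at h
      · have : 0 < β / w.im := by positivity
        linarith
    · have : 0 < α / v.im := by positivity
      linarith
  have hdet : a * c - b ^ 2 = 1 := by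
    rw [← h, cosh_dist_eq, ha, hb, hc]
    field_simp
    ring
  refine ⟨⟨⟨b / a, 1 / a⟩, by simpa using ha0⟩, fun p => ?_⟩
  have hp := p.im_pos
  rw [cosh_dist_eq, cosh_dist_eq, cosh_dist_eq]
  have e1 : UpperHalfPlane.re ⟨⟨b / a, 1 / a⟩, by simpa using ha0⟩ = b / a := rfl
  have e2 : UpperHalfPlane.im ⟨⟨b / a, 1 / a⟩, by simpa using ha0⟩ = 1 / a := rfl
  rw [e1, e2]
  have e3 : ((p.re - b / a) ^ 2 + p.im ^ 2 + (1 / a) ^ 2) / (2 * p.im * (1 / a))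
      = ((p.re ^ 2 + p.im ^ 2) * a - 2 * p.re * b + c) / (2 * p.im) := by
    rw [show c = (b ^ 2 + 1) / a by rw [eq_div_iff ha0.ne']; linarith]
    field_simp
    ring
  rw [e3, ha, hb, hc]
  field_simp
  ring

/-- The segment is an arc of the hyperboloid in the plane spanned by its ends, so `cosh` of the
distance to any `p` is linear in the coefficients. This exact Stewart formula becomes an inequality
in `CAT(-1)` spaces. -/
theorem exists_geodesic (v w : ℍ) : ∃ c : ℝ → ℍ, IsGeodesicSegment c v w ∧
    ∀ t ∈ Set.Icc 0 (dist v w), ∀ p : ℍ, sinh (dist v w) * cosh (dist p (c t)) =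
      sinh (dist v w - t) * cosh (dist p v) + sinh t * cosh (dist p w) := by
  rcases eq_or_ne v w with rfl | hne
  · refine ⟨fun _ => v, ⟨rfl, rfl, ?_⟩, ?_⟩
    · intro s hs t ht
      simp only [dist_self, Set.Icc_self, Set.mem_singleton_iff] at hs ht
      simp [hs, ht]
    · intro t ht p
      simp only [dist_self, Set.Icc_self, Set.mem_singleton_iff] at ht
      simp [ht]
  set D := dist v w with hD
  have hD0 : 0 < D := dist_pos.2 hne
  have hs : 0 < sinh D := Real.sinh_pos_iff.2 hD0
  have key : ∀ t : ℝ, ∃ g : ℍ, t ∈ Set.Icc 0 D → ∀ p : ℍ, sinh D * cosh (dist p g) =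
      sinh (D - t) * cosh (dist p v) + sinh t * cosh (dist p w) := by
    intro t
    by_cases ht : t ∈ Set.Icc 0 D
    · obtain ⟨g, hg⟩ := exists_combination v w (α := sinh (D - t) / sinh D)
        (β := sinh t / sinh D) (div_nonneg (Real.sinh_nonneg_iff.2 (by linarith [ht.2])) hs.le)
        (div_nonneg (Real.sinh_nonneg_iff.2 ht.1) hs.le) (by
          rw [← hD]
          have := sinh_sq_add_identity D t
          field_simp
          linarith)
      refine ⟨g, fun _ p => ?_⟩
      rw [hg p]
      field_simp
    · exact ⟨v, fun h => absurd h ht⟩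
  choose c hc using key
  have h0 : ∀ t ∈ Set.Icc 0 D, dist v (c t) = t := by
    intro t ht
    apply eq_of_cosh_eq dist_nonneg ht.1
    have := hc t ht v
    rw [dist_self, cosh_zero, ← hD, sinh_sub] at this
    have h2 : sinh D * cosh (dist v (c t)) = sinh D * cosh t := by rw [this]; ring
    exact mul_left_cancel₀ hs.ne' h2
  have h1 : ∀ t ∈ Set.Icc 0 D, dist w (c t) = D - t := by
    intro t ht
    apply eq_of_cosh_eq dist_nonneg (by linarith [ht.2])
    have := hc t ht w
    rw [dist_self, cosh_zero, dist_comm w v, ← hD] at this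
    have h2 : sinh D * cosh (dist w (c t)) = sinh D * cosh (D - t) := by
      rw [this, sinh_sub, cosh_sub]
      linear_combination (-sinh t) * Real.cosh_sq D
    exact mul_left_cancel₀ hs.ne' h2
  refine ⟨c, ⟨?_, ?_, ?_⟩, hc⟩
  · exact (dist_eq_zero.1 (h0 0 ⟨le_rfl, hD0.le⟩)).symm
  · have := h1 D ⟨hD0.le, le_rfl⟩
    rw [sub_self] at this
    exact (dist_eq_zero.1 this).symm
  · intro s hs' t ht
    apply eq_of_cosh_eq dist_nonneg (abs_nonneg _)
    rw [cosh_abs]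
    have := hc t ht (c s)
    rw [dist_comm (c s) v, h0 s hs', dist_comm (c s) w, h1 s hs'] at this
    have h2 : sinh D * cosh (dist (c s) (c t)) = sinh D * cosh (s - t) := by
      rw [this, sinh_sub, cosh_sub, cosh_sub]; ring
    exact mul_left_cancel₀ hs.ne' h2

/-- There are comparison triangles in `ℍ`. -/
theorem exists_comparison_triangle {α β c : ℝ} (hα : 0 ≤ α) (hβ : 0 ≤ β) (hc : 0 < c)
    (h1 : α ≤ β + c) (h2 : c ≤ α + β) (h3 : β ≤ α + c) :
    ∃ a b p : ℍ, dist a b = c ∧ dist a p = α ∧ dist b p = β := by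
  have k1 : cosh (c - α) ≤ cosh β := by
    rw [Real.cosh_le_cosh, abs_of_nonneg hβ, abs_le]; constructor <;> linarith
  have k2 : cosh β ≤ cosh (c + α) := by
    rw [Real.cosh_le_cosh, abs_of_nonneg hβ, abs_of_nonneg (by linarith)]; linarith
  have hE : 1 < rexp c := by rw [← Real.exp_zero]; exact Real.exp_lt_exp.2 hc
  have hA : 1 ≤ rexp α := Real.one_le_exp hα
  have cα : cosh α = (rexp α + (rexp α)⁻¹) / 2 := by rw [Real.cosh_eq, Real.exp_neg]
  have cs : cosh (c - α) = (rexp c * (rexp α)⁻¹ + (rexp c)⁻¹ * rexp α) / 2 := by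
    rw [Real.cosh_eq, neg_sub, sub_eq_add_neg, sub_eq_add_neg, Real.exp_add, Real.exp_add,
      Real.exp_neg, Real.exp_neg]; ring
  have cp : cosh (c + α) = (rexp c * rexp α + (rexp c)⁻¹ * (rexp α)⁻¹) / 2 := by
    rw [Real.cosh_eq, neg_add, Real.exp_add, Real.exp_add,
      Real.exp_neg, Real.exp_neg]
  set E := rexp c
  set A := rexp α
  have hE0 : 0 < E := by linarith
  have hA0 : 0 < A := by linarith
  set B := cosh β
  have m1 : E ^ 2 + A ^ 2 ≤ 2 * E * A * B := by
    rw [cs] at k1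
    have : (E * A⁻¹ + E⁻¹ * A) / 2 * (2 * E * A) ≤ B * (2 * E * A) := by gcongr
    have e : (E * A⁻¹ + E⁻¹ * A) / 2 * (2 * E * A) = E ^ 2 + A ^ 2 := by field_simp
    linarith
  have m2 : 2 * E * A * B ≤ E ^ 2 * A ^ 2 + 1 := by
    rw [cp] at k2
    have : B * (2 * E * A) ≤ (E * A + E⁻¹ * A⁻¹) / 2 * (2 * E * A) := by gcongr
    have e : (E * A + E⁻¹ * A⁻¹) / 2 * (2 * E * A) = E ^ 2 * A ^ 2 + 1 := by field_simp
    linarith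
  have hN : 0 < 2 * E * B - 2 * cosh α := by
    rw [cα]
    have : 0 < (2 * E * B - 2 * ((A + A⁻¹) / 2)) * A := by
      have : (2 * E * B - 2 * ((A + A⁻¹) / 2)) * A = 2 * E * A * B - A ^ 2 - 1 := by
        field_simp; ring
      nlinarith
    exact pos_of_mul_pos_left this hA0.le
  -- The vertices are `i`, `E i` and `x + i y`. Subtracting the two distance equations gives `y N =
  -- E² - 1`, and the first then determines `x²`. Nonnegativity of `x²` means `A⁻¹ ≤ y ≤ A`, which
  -- is the triangle inequalities `m1` and `m2`.
  set N := 2 * E * B - 2 * cosh α with hNdef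
  set y := (E ^ 2 - 1) / N with hy
  have hy0 : 0 < y := by apply div_pos _ hN; nlinarith
  have hyN : y * N = E ^ 2 - 1 := by rw [hy]; field_simp
  have hNA : N * A = 2 * E * A * B - A ^ 2 - 1 := by rw [hNdef, cα]; field_simp; ring
  have hyA : y ≤ A := by
    rw [hy, div_le_iff₀ hN]; nlinarith
  have hAy : 1 ≤ y * A := by
    have : N * 1 ≤ N * (y * A) := by
      have : N * (y * A) = (E ^ 2 - 1) * A := by rw [← hyN]; ring
      rw [this]
      have : N * A ≤ (E ^ 2 - 1) * A * A := by nlinarith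
      nlinarith
    exact le_of_mul_le_mul_left this hN
  have hx2 : 0 ≤ 2 * y * cosh α - 1 - y ^ 2 := by
    have e : 2 * y * cosh α - 1 - y ^ 2 = (A - y) * (y - A⁻¹) := by
      rw [cα]; field_simp; ring
    rw [e]
    apply mul_nonneg (by linarith)
    have : A⁻¹ ≤ y := by rw [inv_le_iff_one_le_mul₀ hA0]; exact hAy
    linarith
  set x := √(2 * y * cosh α - 1 - y ^ 2) with hx
  have hxx : x ^ 2 = 2 * y * cosh α - 1 - y ^ 2 := Real.sq_sqrt hx2
  refine ⟨⟨⟨0, 1⟩, one_pos⟩, ⟨⟨0, E⟩, hE0⟩, ⟨⟨x, y⟩, hy0⟩, ?_, ?_, ?_⟩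
  · apply eq_of_cosh_eq dist_nonneg hc.le
    rw [cosh_dist_eq, Real.cosh_eq, Real.exp_neg]
    change ((0 - 0) ^ 2 + 1 ^ 2 + E ^ 2) / (2 * 1 * E) = (E + E⁻¹) / 2
    field_simp; ring
  · apply eq_of_cosh_eq dist_nonneg hα
    rw [cosh_dist_eq]
    change ((0 - x) ^ 2 + 1 ^ 2 + y ^ 2) / (2 * 1 * y) = cosh α
    rw [div_eq_iff (by positivity)]
    linear_combination hxx
  · apply eq_of_cosh_eq dist_nonneg hβ
    rw [cosh_dist_eq]
    change ((0 - x) ^ 2 + E ^ 2 + y ^ 2) / (2 * E * y) = B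
    rw [div_eq_iff (by positivity)]
    linear_combination hxx - hyN

theorem exists_midpoint (v w : ℍ) : ∃ g, dist v g = dist v w / 2 ∧ dist g w = dist v w / 2 := by
  obtain ⟨c, hc, -⟩ := exists_geodesic v w
  have hD : 0 ≤ dist v w := dist_nonneg
  refine ⟨c (dist v w / 2), ?_, ?_⟩
  · have := hc.isometric 0 ⟨le_rfl, hD⟩ (dist v w / 2) ⟨by linarith, by linarith⟩
    rw [hc.source] at this
    rw [this, zero_sub, abs_neg, abs_of_nonneg (by linarith)]
  · have := hc.isometric (dist v w / 2) ⟨by linarith, by linarith⟩ (dist v w) ⟨hD, le_rfl⟩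
    rw [hc.target] at this
    rw [this, abs_sub_comm, abs_of_nonneg (by linarith)]
    ring

/-- A map on `ℍ` that is Lipschitz at some scale is Lipschitz. -/
theorem dist_le_of_local {X : Type*} [MetricSpace X] {f : ℍ → X} {K δ : ℝ} (hδ : 0 < δ)
    (h : ∀ z w, dist z w ≤ δ → dist (f z) (f w) ≤ K * dist z w) (z w : ℍ) :
    dist (f z) (f w) ≤ K * dist z w := by
  have key : ∀ n : ℕ, ∀ z w, dist z w ≤ 2 ^ n * δ → dist (f z) (f w) ≤ K * dist z w := by
    intro n
    induction n with
    | zero => intro z w hzw; exact h z w (by simpa using hzw)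
    | succ n ih =>
      intro z w hzw
      obtain ⟨g, h1, h2⟩ := exists_midpoint z w
      rw [pow_succ] at hzw
      calc dist (f z) (f w) ≤ dist (f z) (f g) + dist (f g) (f w) := dist_triangle _ _ _
        _ ≤ K * dist z g + K * dist g w :=
            add_le_add (ih z g (by rw [h1]; linarith)) (ih g w (by rw [h2]; linarith))
        _ = K * dist z w := by rw [h1, h2]; ring
  obtain ⟨n, hn⟩ := pow_unbounded_of_one_lt (dist z w / δ) (one_lt_two)
  exact key n z w ((div_le_iff₀ hδ).1 hn.le)

end Parabolic

namespace Parabolic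

open Real Filter Topology

/-! ### Triangles in `CAT(-1)` spaces -/

section CAT

variable {M : Type*} [MetricSpace M]

/-- Stewart's inequality in a `CAT(-1)` space. -/
theorem IsCATNegOne.stewart (hM : IsCATNegOne M) {a b : M} {σ : ℝ → M}
    (hσ : IsGeodesicSegment σ a b) {t : ℝ} (ht : t ∈ Set.Icc 0 (dist a b)) (p : M) :
    sinh (dist a b) * cosh (dist p (σ t)) ≤
      sinh (dist a b - t) * cosh (dist p a) + sinh t * cosh (dist p b) := by
  rcases eq_or_ne a b with rfl | hne
  · simp only [dist_self, Set.Icc_self, Set.mem_singleton_iff] at ht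
    simp [ht]
  have hab : 0 < dist a b := dist_pos.2 hne
  obtain ⟨a', b', p', h1, h2, h3⟩ := exists_comparison_triangle (α := dist a p) (β := dist b p)
    (c := dist a b) dist_nonneg dist_nonneg hab
    (by linarith [dist_triangle a b p]) (by linarith [dist_triangle a p b, dist_comm p b])
    (by linarith [dist_triangle b a p, dist_comm a b])
  obtain ⟨τ, hτ⟩ := hM.geodesic a p
  obtain ⟨τ', hτ', -⟩ := exists_geodesic a' p'
  obtain ⟨σ', hσ', hS⟩ := exists_geodesic a' b'
  -- The common vertex is `a`, and the edge towards `p` is used at its far end, so that the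
  -- comparison is between `p` and `σ t`.
  have key := hM.comparison a p b a' p' b' h2 h1 (by rw [dist_comm, h3, dist_comm]) τ σ τ' σ' hτ hσ
    hτ' hσ' (dist a p) ⟨dist_nonneg, le_rfl⟩ t ht
  rw [hτ.target, ← h2, hτ'.target] at key
  have := hS t (by rwa [h1]) p'
  rw [h1, dist_comm p' a', h2, dist_comm p' b', h3, dist_comm a p, dist_comm b p] at this
  rw [← this]
  apply mul_le_mul_of_nonneg_left _ (Real.sinh_nonneg_iff.2 hab.le)
  rw [Real.cosh_le_cosh, abs_of_nonneg dist_nonneg, abs_of_nonneg dist_nonneg]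
  exact key

/-- Stewart's inequality at half length, divided by `sinh (dist a b / 2)`. This strong convexity
survives positive combinations and limits, hence applies to energies and to `exp` of Busemann
functions. -/
theorem IsCATNegOne.exists_midpoint (hM : IsCATNegOne M) (a b : M) : ∃ m : M, ∀ p : M,
    2 * cosh (dist a b / 2) * cosh (dist p m) ≤ cosh (dist p a) + cosh (dist p b) := by
  rcases eq_or_ne a b with rfl | hne
  · exact ⟨a, fun p => by simp; linarith⟩
  obtain ⟨σ, hσ⟩ := hM.geodesic a b
  have hab : 0 < dist a b := dist_pos.2 hne
  refine ⟨σ (dist a b / 2), fun p => ?_⟩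
  have := hM.stewart hσ (t := dist a b / 2) ⟨by linarith, by linarith⟩ p
  rw [show dist a b - dist a b / 2 = dist a b / 2 by ring] at this
  have e : sinh (dist a b) = 2 * sinh (dist a b / 2) * cosh (dist a b / 2) := by
    rw [← Real.sinh_two_mul]; congr 1; ring
  have hs : 0 < sinh (dist a b / 2) := Real.sinh_pos_iff.2 (by linarith)
  rw [e] at this
  refine le_of_mul_le_mul_left ?_ hs
  linarith

theorem one_add_sq_half_le_cosh (x : ℝ) : 1 + x ^ 2 / 2 ≤ cosh x := by
  have h1 : cosh x = 1 + 2 * sinh (|x| / 2) ^ 2 := by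
    rw [← Real.cosh_abs, show |x| = 2 * (|x| / 2) by ring, Real.cosh_two_mul, Real.cosh_sq]
    ring_nf
  have h2 : |x| / 2 ≤ sinh (|x| / 2) := Real.self_le_sinh_iff.2 (by positivity)
  have h3 : (|x| / 2) ^ 2 ≤ sinh (|x| / 2) ^ 2 := by gcongr
  rw [h1]
  rw [div_pow, sq_abs] at h3
  linarith

/-! ### Busemann functions -/

/-- Since `2 cosh f` is asymptotic to `e^f`, this normalization turns hyperbolic identities about
far points into statements about `exp` of Busemann functions. -/
theorem tendsto_exp_mul_cosh {ι : Type*} {l : Filter ι} {u f : ι → ℝ} {a : ℝ}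
    (hu : Tendsto u l atTop) (hf : Tendsto (fun i => f i - u i) l (𝓝 a)) :
    Tendsto (fun i => 2 * rexp (-u i) * cosh (f i)) l (𝓝 (rexp a)) := by
  have h1 : Tendsto (fun i => rexp (f i - u i)) l (𝓝 (rexp a)) :=
    (Real.continuous_exp.tendsto a).comp hf
  have h2 : Tendsto (fun i => rexp (-u i) * rexp (-u i) * rexp (-(f i - u i))) l
      (𝓝 (0 * 0 * rexp (-a))) := by
    have h3 : Tendsto (fun i => rexp (-u i)) l (𝓝 0) := Real.tendsto_exp_neg_atTop_nhds_zero.comp hu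
    exact (h3.mul h3).mul ((Real.continuous_exp.tendsto _).comp hf.neg)
  have h4 := h1.add h2
  rw [zero_mul, zero_mul, add_zero] at h4
  refine h4.congr fun i => ?_
  rw [Real.cosh_eq, ← Real.exp_add, ← Real.exp_add]
  have e1 : rexp (f i - u i) = rexp (-u i) * rexp (f i) := by rw [← Real.exp_add]; ring_nf
  have e2 : rexp (-u i + -u i + -(f i - u i)) = rexp (-u i) * rexp (-f i) := by
    rw [← Real.exp_add]; ring_nf
  rw [e1, e2]; ring

theorem tendsto_exp_mul_sinh {ι : Type*} {l : Filter ι} {u f : ι → ℝ} {a : ℝ}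
    (hu : Tendsto u l atTop) (hf : Tendsto (fun i => f i - u i) l (𝓝 a)) :
    Tendsto (fun i => 2 * rexp (-u i) * sinh (f i)) l (𝓝 (rexp a)) := by
  have h1 : Tendsto (fun i => rexp (f i - u i)) l (𝓝 (rexp a)) :=
    (Real.continuous_exp.tendsto a).comp hf
  have h2 : Tendsto (fun i => rexp (-u i) * rexp (-u i) * rexp (-(f i - u i))) l
      (𝓝 (0 * 0 * rexp (-a))) := by
    have h3 : Tendsto (fun i => rexp (-u i)) l (𝓝 0) := Real.tendsto_exp_neg_atTop_nhds_zero.comp hu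
    exact (h3.mul h3).mul ((Real.continuous_exp.tendsto _).comp hf.neg)
  have h4 := h1.sub h2
  rw [zero_mul, zero_mul, sub_zero] at h4
  refine h4.congr fun i => ?_
  rw [Real.sinh_eq, ← Real.exp_add, ← Real.exp_add]
  have e1 : rexp (f i - u i) = rexp (-u i) * rexp (f i) := by rw [← Real.exp_add]; ring_nf
  have e2 : rexp (-u i + -u i + -(f i - u i)) = rexp (-u i) * rexp (-f i) := by
    rw [← Real.exp_add]; ring_nf
  rw [e1, e2]; ring

/-- The Busemann function of the ray `c`. -/
noncomputable def busemann (c : GeodesicRay M) (x : M) : ℝ := ⨅ t : ℝ≥0, (dist x (c.1 t) - t)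

variable (c : GeodesicRay M)

theorem dist_ray (s t : ℝ≥0) : dist (c.1 s) (c.1 t) = |(s : ℝ) - t| := by
  rw [c.2.dist_eq, NNReal.dist_eq]

theorem antitone_dist_ray (x : M) : Antitone fun t : ℝ≥0 => dist x (c.1 t) - t := by
  intro s t hst
  have h : (s : ℝ) ≤ t := hst
  have h1 := dist_triangle x (c.1 s) (c.1 t)
  rw [dist_ray, abs_sub_comm, abs_of_nonneg (by linarith)] at h1
  simp only
  linarith

theorem bddBelow_dist_ray (x : M) : BddBelow (Set.range fun t : ℝ≥0 => dist x (c.1 t) - t) := by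
  refine ⟨-dist x (c.1 0), ?_⟩
  rintro _ ⟨t, rfl⟩
  have h1 := dist_triangle_left (c.1 0) (c.1 t) x
  rw [dist_ray, abs_sub_comm, abs_of_nonneg (by simp)] at h1
  simp at h1 ⊢
  linarith

theorem tendsto_busemann (x : M) :
    Tendsto (fun t : ℝ≥0 => dist x (c.1 t) - t) atTop (𝓝 (busemann c x)) :=
  tendsto_atTop_ciInf (antitone_dist_ray c x) (bddBelow_dist_ray c x)

theorem busemann_le (x : M) (t : ℝ≥0) : busemann c x ≤ dist x (c.1 t) - t :=
  ciInf_le (bddBelow_dist_ray c x) t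

theorem busemann_sub_le (x y : M) : busemann c x - busemann c y ≤ dist x y := by
  have : busemann c x - dist x y ≤ busemann c y := by
    apply le_ciInf
    intro t
    linarith [busemann_le c x t, dist_triangle x y (c.1 t)]
  linarith

theorem dist_busemann_le (x y : M) : dist (busemann c x) (busemann c y) ≤ dist x y := by
  rw [Real.dist_eq, abs_le]
  constructor
  · linarith [busemann_sub_le c y x, dist_comm x y]
  · exact busemann_sub_le c x y

theorem continuous_busemann : Continuous (busemann c) :=
  (LipschitzWith.of_dist_le_mul (K := 1) (by simpa using dist_busemann_le c)).continuous

theorem tendsto_coe_nnreal : Tendsto (fun t : ℝ≥0 => (t : ℝ)) atTop atTop :=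
  NNReal.tendsto_coe_atTop.2 tendsto_id

theorem tendsto_cosh_dist_ray (x : M) :
    Tendsto (fun t : ℝ≥0 => 2 * rexp (-t) * cosh (dist x (c.1 t))) atTop
      (𝓝 (rexp (busemann c x))) :=
  tendsto_exp_mul_cosh tendsto_coe_nnreal (tendsto_busemann c x)

/-- Linear inequalities between the functions `cosh d(p, ·)` pass to `exp` of the Busemann
functions. -/
theorem exp_busemann_le {a b m : M} {k α β : ℝ}
    (h : ∀ p : M, k * cosh (dist p m) ≤ α * cosh (dist p a) + β * cosh (dist p b)) :
    k * rexp (busemann c m) ≤ α * rexp (busemann c a) + β * rexp (busemann c b) := by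
  refine le_of_tendsto_of_tendsto' ((tendsto_cosh_dist_ray c m).const_mul k)
    (((tendsto_cosh_dist_ray c a).const_mul α).add ((tendsto_cosh_dist_ray c b).const_mul β))
    fun t => ?_
  have := h (c.1 t)
  rw [dist_comm _ m, dist_comm _ a, dist_comm _ b] at this
  have h0 : 0 ≤ 2 * rexp (-t) := by positivity
  have := mul_le_mul_of_nonneg_left this h0
  linarith

/-! ### Pushing towards a point at infinity -/

/-- `y` is obtained from `x` by moving during time `s` towards the endpoint of `c`. -/
structure IsPush (c : GeodesicRay M) (x : M) (s : ℝ) (y : M) : Prop where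
  dist_le : dist x y ≤ s
  busemann_le : busemann c y ≤ busemann c x - s

variable {c}

theorem IsPush.nonneg {x y : M} {s : ℝ} (h : IsPush c x s y) : 0 ≤ s := dist_nonneg.trans h.dist_le

theorem IsPush.busemann_eq {x y : M} {s : ℝ} (h : IsPush c x s y) :
    busemann c y = busemann c x - s := by
  have := busemann_sub_le c x y
  linarith [h.dist_le, h.busemann_le]

/-- The midpoint of `y` and `z` stays within `s` of `x`, so its Busemann value is at least that of
`x` minus `s`; convexity pushes it below the values at `y` and `z` by the factor `cosh (dist y z /
2)`. The case `ε = 0` is uniqueness of pushes, and `ε → 0` makes approximate pushes Cauchy. -/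
theorem cosh_half_dist_le (hM : IsCATNegOne M) {x y z : M} {s ε : ℝ} (hy : dist x y ≤ s)
    (hz : dist x z ≤ s) (hby : busemann c y ≤ busemann c x - s + ε)
    (hbz : busemann c z ≤ busemann c x - s + ε) : cosh (dist y z / 2) ≤ rexp ε := by
  obtain ⟨m, hm⟩ := hM.exists_midpoint y z
  have hs : 0 ≤ s := dist_nonneg.trans hy
  have h1 := hm x
  have cy : cosh (dist x y) ≤ cosh s := by
    rwa [Real.cosh_le_cosh, abs_of_nonneg dist_nonneg, abs_of_nonneg hs]
  have cz : cosh (dist x z) ≤ cosh s := by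
    rwa [Real.cosh_le_cosh, abs_of_nonneg dist_nonneg, abs_of_nonneg hs]
  have hc1 := Real.one_le_cosh (dist y z / 2)
  have hc2 := Real.one_le_cosh (dist x m)
  have cm : cosh (dist x m) ≤ cosh s := by nlinarith
  rw [Real.cosh_le_cosh, abs_of_nonneg dist_nonneg, abs_of_nonneg hs] at cm
  have hbm : busemann c x - s ≤ busemann c m := by linarith [busemann_sub_le c x m]
  have h2 := exp_busemann_le c (a := y) (b := z) (m := m) (k := 2 * cosh (dist y z / 2)) (α := 1) (β := 1)
    (fun p => by linarith [hm p])
  have e1 := Real.exp_le_exp.2 hby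
  have e2 := Real.exp_le_exp.2 hbz
  have e3 := Real.exp_le_exp.2 hbm
  rw [Real.exp_add] at e1 e2
  have h0 := Real.exp_pos (busemann c x - s)
  refine le_of_mul_le_mul_right ?_ h0
  nlinarith

theorem IsPush.unique (hM : IsCATNegOne M) {x y z : M} {s : ℝ} (hy : IsPush c x s y)
    (hz : IsPush c x s z) : y = z := by
  have := cosh_half_dist_le hM (ε := 0) hy.dist_le hz.dist_le (by simpa using hy.busemann_le)
    (by simpa using hz.busemann_le)
  rw [Real.exp_zero, ← Real.cosh_zero, Real.cosh_le_cosh, abs_zero, abs_nonpos_iff] at this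
  exact dist_eq_zero.1 (by linarith)

/-- The push is the limit of the points at distance `s` from `x` on the segments from `x` to `c n`.
The last inequality is the limit of Stewart's inequality along these segments. -/
theorem exists_isPush [CompleteSpace M] (hM : IsCATNegOne M) (c : GeodesicRay M) (x : M) {s : ℝ}
    (hs : 0 ≤ s) : ∃ y, IsPush c x s y ∧ ∀ q, rexp (busemann c x) * cosh (dist q y) ≤
      rexp (busemann c x - s) * cosh (dist q x) + sinh s * rexp (busemann c q) := by
  set D : ℕ → ℝ := fun n => dist x (c.1 n) with hD
  have hcast : Tendsto (fun n : ℕ => (n : ℝ≥0)) atTop atTop := tendsto_natCast_atTop_atTop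
  have hβ : ∀ q, Tendsto (fun n : ℕ => dist q (c.1 n) - (n : ℝ)) atTop (𝓝 (busemann c q)) := by
    intro q
    have := (tendsto_busemann c q).comp hcast
    simpa [Function.comp_def] using this
  have hβx : Tendsto (fun n : ℕ => D n - (n : ℝ)) atTop (𝓝 (busemann c x)) := hβ x
  have hR : Tendsto (fun n : ℕ => (n : ℝ)) atTop atTop := tendsto_natCast_atTop_atTop
  have hDtop : Tendsto D atTop atTop := by
    have := hβx.add_atTop hR
    simpa using this
  obtain ⟨N, hN⟩ := (hDtop.eventually_ge_atTop s).exists_forall_of_atTop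
  have key : ∀ n : ℕ, ∃ y, dist x y = s ∧ dist y (c.1 ↑(n + N)) = D (n + N) - s ∧
      ∀ q, sinh (D (n + N)) * cosh (dist q y) ≤
        sinh (D (n + N) - s) * cosh (dist q x) + sinh s * cosh (dist q (c.1 ↑(n + N))) := by
    intro n
    obtain ⟨σ, hσ⟩ := hM.geodesic x (c.1 ↑(n + N))
    have hsD : s ≤ D (n + N) := hN _ (by omega)
    have hD0 : 0 ≤ D (n + N) := dist_nonneg
    refine ⟨σ s, ?_, ?_, fun q => hM.stewart hσ ⟨hs, hsD⟩ q⟩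
    · have := hσ.isometric 0 ⟨le_rfl, hD0⟩ s ⟨hs, hsD⟩
      rw [hσ.source] at this
      rw [this, zero_sub, abs_neg, abs_of_nonneg hs]
    · have := hσ.isometric s ⟨hs, hsD⟩ _ ⟨hD0, le_rfl⟩
      rw [hσ.target] at this
      rw [this, abs_sub_comm, abs_of_nonneg (by linarith)]
  choose y hy1 hy2 hy3 using key
  have hshift : Tendsto (fun n : ℕ => n + N) atTop atTop := tendsto_add_atTop_nat N
  have hby : ∀ n, busemann c (y n) ≤ D (n + N) - (↑(n + N) : ℝ) - s := by
    intro n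
    have := busemann_le c (y n) ↑(n + N)
    rw [hy2] at this
    push_cast at this ⊢
    linarith
  -- By `hby`, the `n`-th point fails to be a push by at most `β n`, which decreases to 0. The shift
  -- by `N` makes every segment at least `s` long.
  set β : ℕ → ℝ := fun n => D (n + N) - (↑(n + N) : ℝ) - busemann c x with hβdef
  have hβ0 : Tendsto β atTop (𝓝 0) := by
    have := (hβx.comp hshift).sub_const (busemann c x)
    simpa [Function.comp_def, hβdef] using this
  have hβanti : ∀ n m, n ≤ m → β m ≤ β n := by
    intro n m hnm
    have h1 : ((n + N : ℕ) : ℝ≥0) ≤ ((m + N : ℕ) : ℝ≥0) := by exact_mod_cast Nat.add_le_add_right hnm N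
    have := antitone_dist_ray c x h1
    simp only at this
    simp only [hβdef, hD]
    push_cast at this ⊢
    linarith
  have hcau : CauchySeq y := by
    refine cauchySeq_of_le_tendsto_0 (fun n => √(8 * (rexp (β n) - 1))) ?_ ?_
    · intro n m k hkn hkm
      have h := cosh_half_dist_le hM (c := c) (x := x) (ε := β k) (hy1 n).le (hy1 m).le
        (by linarith [hby n, hβanti k n hkn, show β n = _ from rfl])
        (by linarith [hby m, hβanti k m hkm, show β m = _ from rfl])
      apply Real.le_sqrt_of_sq_le
      have := one_add_sq_half_le_cosh (dist (y n) (y m) / 2)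
      nlinarith
    · have h1 : Tendsto (fun n => 8 * (rexp (β n) - 1)) atTop (𝓝 (8 * (rexp 0 - 1))) :=
        (((Real.continuous_exp.tendsto 0).comp hβ0).sub_const 1).const_mul 8
      have := (Real.continuous_sqrt.tendsto _).comp h1
      simpa [Function.comp_def] using this
  obtain ⟨z, hz⟩ := cauchySeq_tendsto_of_complete hcau
  refine ⟨z, ⟨?_, ?_⟩, fun q => ?_⟩
  · exact le_of_tendsto' (tendsto_const_nhds.dist hz) fun n => (hy1 n).le
  · have h1 : Tendsto (fun n => β n + busemann c x - s) atTop (𝓝 (0 + busemann c x - s)) :=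
      (hβ0.add_const _).sub_const _
    rw [zero_add] at h1
    refine le_of_tendsto_of_tendsto' (((continuous_busemann c).tendsto z).comp hz) h1 fun n => ?_
    have := hby n
    simp only [Function.comp, hβdef]
    linarith
  · have hu : Tendsto (fun n : ℕ => (↑(n + N) : ℝ)) atTop atTop := hR.comp hshift
    have l1 := tendsto_exp_mul_sinh hu (hβx.comp hshift)
    have l2 := tendsto_exp_mul_sinh (f := fun n => D (n + N) - s) (a := busemann c x - s) hu (by
      have := (hβx.comp hshift).sub_const s
      refine this.congr fun n => ?_
      simp only [Function.comp]; ring)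
    have l3 := tendsto_exp_mul_cosh hu ((hβ q).comp hshift)
    have l4 : Tendsto (fun n => cosh (dist q (y n))) atTop (𝓝 (cosh (dist q z))) :=
      (Real.continuous_cosh.tendsto _).comp (tendsto_const_nhds.dist hz)
    refine le_of_tendsto_of_tendsto' (l1.mul l4) ((l2.mul_const _).add (l3.const_mul (sinh s)))
      fun n => ?_
    have h0 : 0 ≤ 2 * rexp (-(↑(n + N) : ℝ)) := by positivity
    have := mul_le_mul_of_nonneg_left (hy3 n q) h0
    linarith

theorem IsPush.cosh_dist_le [CompleteSpace M] (hM : IsCATNegOne M) {x y : M} {s : ℝ}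
    (h : IsPush c x s y) (q : M) : rexp (busemann c x) * cosh (dist q y) ≤
      rexp (busemann c x - s) * cosh (dist q x) + sinh s * rexp (busemann c q) := by
  obtain ⟨z, hz, hq⟩ := exists_isPush hM c x h.nonneg
  rw [h.unique hM hz]
  exact hq q

/-- The differences of Busemann values satisfy the push inequality with equality: `cosh (v + s) =
e^{-s} cosh v + sinh s e^v`. Subtracting leaves only the factor `e^{-s}`. -/
theorem IsPush.contraction_left [CompleteSpace M] (hM : IsCATNegOne M) {x y : M} {s : ℝ}
    (h : IsPush c x s y) (q : M) : cosh (dist q y) - cosh (busemann c q - busemann c y) ≤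
      rexp (-s) * (cosh (dist q x) - cosh (busemann c q - busemann c x)) := by
  have h1 := h.cosh_dist_le hM q
  set v := busemann c q - busemann c x with hv
  have e : cosh (busemann c q - busemann c y) = rexp (-s) * cosh v + sinh s * rexp v := by
    rw [h.busemann_eq, show busemann c q - (busemann c x - s) = v + s by rw [hv]; ring,
      Real.cosh_eq, Real.cosh_eq, Real.sinh_eq, neg_add, Real.exp_add, Real.exp_add]
    ring
  rw [e]
  have h2 : cosh (dist q y) ≤ rexp (-s) * cosh (dist q x) + sinh s * rexp v := by
    refine le_of_mul_le_mul_left ?_ (Real.exp_pos (busemann c x))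
    refine h1.trans_eq ?_
    rw [sub_eq_add_neg, Real.exp_add, hv, sub_eq_add_neg, Real.exp_add, Real.exp_neg (busemann c x)]
    field_simp
  linarith

/-- Pushing towards infinity contracts horospheres exponentially. -/
theorem IsPush.contraction [CompleteSpace M] (hM : IsCATNegOne M) {x x' y y' : M} {s t : ℝ}
    (hx : IsPush c x s x') (hy : IsPush c y t y') :
    cosh (dist x' y') - cosh (busemann c x' - busemann c y') ≤
      rexp (-(s + t)) * (cosh (dist x y) - cosh (busemann c x - busemann c y)) := by
  have h1 := hx.contraction_left hM y'
  have h2 := hy.contraction_left hM x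
  rw [dist_comm, ← Real.cosh_neg (_ - _), neg_sub, dist_comm y' x,
    ← Real.cosh_neg (busemann c y' - busemann c x), neg_sub] at h1
  refine h1.trans ?_
  rw [neg_add, Real.exp_add, mul_assoc]
  exact mul_le_mul_of_nonneg_left h2 (Real.exp_pos _).le

/-! ### Isometries fixing a point at infinity -/

/-- Stewart's inequality holds for `exp` of the Busemann function on the segment of `c'` from 0 to
`u`. Its far end contributes at most `e^{C - u}`, which disappears as `u → ∞`. -/
theorem isPush_of_asymptotic (hM : IsCATNegOne M) {c c' : GeodesicRay M} {C : ℝ}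
    (hC : ∀ t : ℝ≥0, dist (c'.1 t) (c.1 t) ≤ C) (t : ℝ≥0) : IsPush c (c'.1 0) t (c'.1 t) := by
  refine ⟨by rw [dist_ray]; simp, ?_⟩
  have hb : ∀ u : ℝ≥0, busemann c (c'.1 u) ≤ C - u := fun u =>
    (busemann_le c _ u).trans (by linarith [hC u])
  have key : ∀ u : ℝ≥0, t ≤ u → sinh u * rexp (busemann c (c'.1 t)) ≤
      sinh (u - t) * rexp (busemann c (c'.1 0)) + sinh t * rexp (C - u) := by
    intro u htu
    have htu' : (t : ℝ) ≤ u := htu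
    have hd : dist (c'.1 0) (c'.1 u) = u := by rw [dist_ray]; simp
    have hσ : IsGeodesicSegment (fun r : ℝ => c'.1 r.toNNReal) (c'.1 0) (c'.1 u) := by
      refine ⟨by simp, by rw [hd]; simp, ?_⟩
      intro r hr r' hr'
      rw [dist_ray, Real.coe_toNNReal _ hr.1, Real.coe_toNNReal _ hr'.1]
    have h1 := exp_busemann_le c fun p => hM.stewart hσ (t := t) (by rw [hd]; exact ⟨t.2, htu'⟩) p
    rw [hd] at h1
    simp only [Real.toNNReal_coe] at h1
    refine h1.trans ?_
    have : 0 ≤ sinh (t : ℝ) := Real.sinh_nonneg_iff.2 t.2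
    gcongr
    exact hb u
  have hu := tendsto_coe_nnreal
  have l1 := tendsto_exp_mul_sinh (f := fun u : ℝ≥0 => (u : ℝ)) (a := 0) hu (by simp)
  have l2 := tendsto_exp_mul_sinh (f := fun u : ℝ≥0 => (u : ℝ) - t) (a := -t) hu
    (by simp)
  have l3 : Tendsto (fun u : ℝ≥0 => 2 * rexp (-u) * (sinh t * rexp (C - u))) atTop
      (𝓝 (2 * 0 * (sinh t * 0))) := by
    have h3 : Tendsto (fun u : ℝ≥0 => rexp (-(u : ℝ))) atTop (𝓝 0) :=
      Real.tendsto_exp_neg_atTop_nhds_zero.comp hu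
    have h4 : Tendsto (fun u : ℝ≥0 => rexp (C - (u : ℝ))) atTop (𝓝 0) := by
      have := h3.const_mul (rexp C)
      rw [mul_zero] at this
      refine this.congr fun u => ?_
      rw [← Real.exp_add]; rfl
    exact (h3.const_mul 2).mul (h4.const_mul _)
  have h5 : rexp 0 * rexp (busemann c (c'.1 t)) ≤
      rexp (-t) * rexp (busemann c (c'.1 0)) + 2 * 0 * (sinh t * 0) := by
    refine le_of_tendsto_of_tendsto (l1.mul_const _) ((l2.mul_const _).add l3) ?_
    filter_upwards [eventually_ge_atTop t] with u hu
    have h0 : 0 ≤ 2 * rexp (-(u : ℝ)) := by positivity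
    have := mul_le_mul_of_nonneg_left (key u hu) h0
    linarith
  rw [Real.exp_zero, one_mul, mul_zero, zero_mul, add_zero, ← Real.exp_add, Real.exp_le_exp] at h5
  linarith

/-- The points of `c'` are pushes of `c' 0` towards the end of `c`. The upper bound is the limit of
their push inequality; the lower one holds because `busemann c` is 1-Lipschitz. -/
theorem busemann_of_asymptotic [CompleteSpace M] (hM : IsCATNegOne M) {c c' : GeodesicRay M} {C : ℝ}
    (hC : ∀ t : ℝ≥0, dist (c'.1 t) (c.1 t) ≤ C) (q : M) :
    busemann c' q = busemann c q - busemann c (c'.1 0) := by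
  apply le_antisymm
  · have key : ∀ t : ℝ≥0, rexp (busemann c (c'.1 0)) * cosh (dist q (c'.1 t)) ≤
        rexp (busemann c (c'.1 0) - t) * cosh (dist q (c'.1 0)) + sinh t * rexp (busemann c q) :=
      fun t => (isPush_of_asymptotic hM hC t).cosh_dist_le hM q
    have hu := tendsto_coe_nnreal
    have l1 := (tendsto_cosh_dist_ray c' q).const_mul (rexp (busemann c (c'.1 0)))
    have l2 := tendsto_exp_mul_sinh (f := fun u : ℝ≥0 => (u : ℝ)) (a := 0) hu (by simp)
    have l3 : Tendsto (fun u : ℝ≥0 => 2 * rexp (-u) * (rexp (busemann c (c'.1 0) - u) *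
        cosh (dist q (c'.1 0)))) atTop (𝓝 (2 * 0 * (0 * cosh (dist q (c'.1 0))))) := by
      have h3 : Tendsto (fun u : ℝ≥0 => rexp (-(u : ℝ))) atTop (𝓝 0) :=
        Real.tendsto_exp_neg_atTop_nhds_zero.comp hu
      have h4 : Tendsto (fun u : ℝ≥0 => rexp (busemann c (c'.1 0) - (u : ℝ))) atTop (𝓝 0) := by
        have := h3.const_mul (rexp (busemann c (c'.1 0)))
        rw [mul_zero] at this
        refine this.congr fun u => ?_
        rw [← Real.exp_add]; rfl
      exact (h3.const_mul 2).mul (h4.mul_const _)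
    have h5 := le_of_tendsto_of_tendsto' l1 (l3.add (l2.mul_const (rexp (busemann c q)))) fun t => by
      have h0 : 0 ≤ 2 * rexp (-(t : ℝ)) := by positivity
      have := mul_le_mul_of_nonneg_left (key t) h0
      linarith
    rw [Real.exp_zero, one_mul, zero_mul, mul_zero, zero_add, ← Real.exp_add, Real.exp_le_exp] at h5
    linarith
  · apply le_ciInf
    intro t
    have := (isPush_of_asymptotic hM hC t).busemann_le
    linarith [busemann_sub_le c q (c'.1 t)]

/-- An isometry fixing the endpoint of `c` translates the Busemann function. -/
theorem busemann_isometry [CompleteSpace M] (hM : IsCATNegOne M) (c : GeodesicRay M) (g : M ≃ᵢ M)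
    (hg : boundaryMap g (Quotient.mk (asymptotic M) c) = Quotient.mk (asymptotic M) c) (x : M) :
    busemann c (g x) = busemann c x + busemann c (g (c.1 0)) := by
  obtain ⟨C, hC⟩ : ∃ C : ℝ, ∀ t : ℝ≥0, dist ((mapRay g c).1 t) (c.1 t) ≤ C := Quotient.exact hg
  have h1 := busemann_of_asymptotic hM hC (g x)
  have h2 : busemann (mapRay g c) (g x) = busemann c x := by
    unfold busemann mapRay
    simp [g.dist_eq]
  rw [h2] at h1
  have h3 : (mapRay g c).1 0 = g (c.1 0) := rfl
  rw [h3] at h1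
  linarith

theorem IsPush.map {x y : M} {s μ : ℝ} (h : IsPush c x s y) (g : M ≃ᵢ M)
    (hg : ∀ x, busemann c (g x) = busemann c x + μ) : IsPush c (g x) s (g y) :=
  ⟨by rw [g.dist_eq]; exact h.dist_le, by rw [hg, hg]; linarith [h.busemann_le]⟩

/-- Pushing commutes with `g`, so a push `y` by time `s` satisfies `cosh d(y, g y) ≤ cosh μ +
e^{-2s} E`. The infimum is approached as `s → ∞` and need not be attained. -/
theorem translationLength_eq [CompleteSpace M] (hM : IsCATNegOne M) (g : M ≃ᵢ M) {μ : ℝ}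
    (hg : ∀ x, busemann c (g x) = busemann c x + μ) : translationLength g = |μ| := by
  have hbdd : BddBelow (Set.range fun x : M => dist x (g x)) :=
    ⟨0, by rintro _ ⟨x, rfl⟩; exact dist_nonneg⟩
  have : Nonempty M := ⟨c.1 0⟩
  have h0 : 0 ≤ translationLength g := Real.iInf_nonneg fun x => dist_nonneg
  apply le_antisymm
  · rw [← abs_of_nonneg h0, ← Real.cosh_le_cosh]
    set x := c.1 0
    set E := cosh (dist x (g x)) - cosh (busemann c x - busemann c (g x))
    have key : ∀ s : ℝ≥0, cosh (translationLength g) ≤ cosh μ + rexp (-s) * rexp (-s) * E := by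
      intro s
      obtain ⟨y, hy, -⟩ := exists_isPush hM c x s.2
      have h1 := hy.contraction hM (hy.map g hg)
      rw [neg_add, Real.exp_add, hg y, sub_add_cancel_left, Real.cosh_neg] at h1
      have h2 : cosh (translationLength g) ≤ cosh (dist y (g y)) := by
        rw [Real.cosh_le_cosh, abs_of_nonneg h0, abs_of_nonneg dist_nonneg]
        exact ciInf_le hbdd y
      have h3 : cosh (dist y (g y)) - cosh μ ≤ rexp (-s) * rexp (-s) * E := h1
      linarith
    have h3 : Tendsto (fun u : ℝ≥0 => rexp (-(u : ℝ))) atTop (𝓝 0) :=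
      Real.tendsto_exp_neg_atTop_nhds_zero.comp tendsto_coe_nnreal
    have h4 := (((h3.mul h3).mul_const E).const_add (cosh μ))
    have := ge_of_tendsto' h4 key
    simpa using this
  · apply le_ciInf
    intro x
    have := dist_busemann_le c x (g x)
    rwa [Real.dist_eq, hg, sub_add_cancel_left, abs_neg] at this

end CAT

end Parabolic

namespace Parabolic

open Filter Topology

/-! ### The action of the fundamental group on the universal cover -/

/-- The action of `Γ` on `ℍ` by isometries is metrically proper. -/
def IsMetricallyProper {Γ : Type*} [Group Γ] (k : Γ →* (ℍ ≃ᵢ ℍ)) : Prop :=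
  ∀ (z w : ℍ) (R : ℝ), {γ : Γ | dist z (k γ w) ≤ R}.Finite

/-- The action of `Γ` on `ℍ` by isometries is cobounded. -/
def IsCobounded {Γ : Type*} [Group Γ] (k : Γ →* (ℍ ≃ᵢ ℍ)) : Prop :=
  ∀ w : ℍ, ∃ R : ℝ, ∀ z : ℍ, ∃ γ : Γ, dist z (k γ w) ≤ R

/-- The action of `Γ` on `ℍ` is by orientation preserving isometries. -/
def ActsBySL {Γ : Type*} [Group Γ] (k : Γ →* (ℍ ≃ᵢ ℍ)) : Prop :=
  ∀ γ : Γ, ∃ A : SL(2, ℝ), ∀ z : ℍ, k γ z = A • z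

/-- The deck transformations of `p` that preserve the orientation and the metric. -/
def deckGroup {S : Type*} (p : ℍ → S) : Subgroup (ℍ ≃ᵢ ℍ) where
  carrier := {g | (∃ A : SL(2, ℝ), ∀ z : ℍ, g z = A • z) ∧ ∀ z, p (g z) = p z}
  one_mem' := ⟨⟨1, fun z => by simp⟩, fun z => rfl⟩
  mul_mem' := by
    rintro g h ⟨⟨A, hA⟩, hg⟩ ⟨⟨B, hB⟩, hh⟩
    refine ⟨⟨A * B, fun z => ?_⟩, fun z => ?_⟩
    · rw [IsometryEquiv.mul_apply, hA, hB, mul_smul]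
    · rw [IsometryEquiv.mul_apply, hg, hh]
  inv_mem' := by
    rintro g ⟨⟨A, hA⟩, hg⟩
    refine ⟨⟨A⁻¹, fun z => ?_⟩, fun z => ?_⟩
    · rw [eq_inv_smul_iff, ← hA, IsometryEquiv.apply_inv_self]
    · rw [← hg, IsometryEquiv.apply_inv_self]

/-- Isometries act on `ℍ`. -/
@[reducible] noncomputable def deckAction {S : Type*} (p : ℍ → S) : MulAction (deckGroup p) ℍ where
  smul g z := g.1 z
  one_smul _ := rfl
  mul_smul _ _ _ := rfl

/-- `g` and the identity are lifts of `p` through `p` that agree at `u`. -/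
theorem deckGroup_free {S : Type*} [TopologicalSpace S] {p : ℍ → S} (hp : IsCoveringMap p)
    {g : ℍ ≃ᵢ ℍ} (hg : g ∈ deckGroup p) {u : ℍ} (hu : g u = u) : g = 1 := by
  have := hp.eq_of_comp_eq g.continuous continuous_id (funext hg.2) u hu
  ext1 z
  exact congrFun this z

theorem isQuotientCoveringMap_deck {S : Type*} [TopologicalSpace S] {p : ℍ → S}
    (hp : IsCoveringMap p) (hs : Function.Surjective p)
    (hd : ∀ z w : ℍ, p z = p w → ∃ A : SL(2, ℝ), A • z = w ∧ ∀ u : ℍ, p (A • u) = p u) :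
    letI := deckAction p
    IsQuotientCoveringMap p (deckGroup p) := by
  let _ := deckAction p
  refine { hp.isQuotientMap hs with
    continuous_const_smul := fun g => g.1.continuous
    apply_eq_iff_mem_orbit := ?_
    disjoint := ?_ }
  · intro z w
    constructor
    · intro h
      obtain ⟨A, hA, hpA⟩ := hd w z h.symm
      exact ⟨⟨IsometryEquiv.constSMul A, ⟨A, fun z => rfl⟩, hpA⟩, hA⟩
    · rintro ⟨g, rfl⟩
      exact g.2.2 w
  · intro z
    obtain ⟨U, hU, hzU, hinj⟩ := hp.isLocalHomeomorph.isLocallyInjective z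
    refine ⟨U, hU.mem_nhds hzU, ?_⟩
    rintro g ⟨_, ⟨u, hu, rfl⟩, hgu⟩
    exact Subtype.ext (deckGroup_free hp g.2 (hinj hgu hu (g.2.2 u)))

theorem finite_fiber_inter {S : Type*} [TopologicalSpace S] [T1Space S] {p : ℍ → S}
    (hp : IsCoveringMap p) (x : S) (z : ℍ) (R : ℝ) :
    (p ⁻¹' {x} ∩ Metric.closedBall z R).Finite := by
  have hc : IsCompact (p ⁻¹' {x} ∩ Metric.closedBall z R) :=
    (isCompact_closedBall z R).inter_left (isClosed_singleton.preimage hp.continuous)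
  have : DiscreteTopology (p ⁻¹' {x}) := (hp x).1
  have hd : IsDiscrete (p ⁻¹' {x}) := ⟨this⟩
  exact hc.finite (hd.mono Set.inter_subset_left)

/-- The fundamental group of a closed hyperbolic surface acts on `ℍ` by orientation preserving
isometries, properly and coboundedly. -/
theorem exists_cobounded_action {S : Type*} [TopologicalSpace S] (hS : IsClosedHyperbolicSurface S)
    (x₀ : S) : ∃ k : FundamentalGroup S x₀ →* (ℍ ≃ᵢ ℍ),
      ActsBySL k ∧ IsMetricallyProper k ∧ IsCobounded k := by
  obtain ⟨p, hp, hs, hd⟩ := hS.uniformization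
  have := hS.compact
  have := hS.hausdorff
  let _ := deckAction p
  have hq := isQuotientCoveringMap_deck hp hs hd
  obtain ⟨e, he⟩ := hs x₀
  let E : FundamentalGroup S x₀ ≃* (deckGroup p)ᵐᵒᵖ := hq.fundamentalGroupEquiv ⟨e, he⟩
  -- The identification with deck transformations reverses products; inversion corrects this.
  let E' : FundamentalGroup S x₀ ≃* deckGroup p := E.trans (MulEquiv.inv' (deckGroup p)).symm
  refine ⟨(deckGroup p).subtype.comp E'.toMonoidHom, fun γ => (E' γ).2.1, ?_, ?_⟩
  · intro z w R
    refine ((finite_fiber_inter hp (p w) z R).preimage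
      (f := fun γ => (E' γ).1 w) ?_).subset ?_
    · intro γ _ δ _ h
      apply E'.injective
      have h1 : ((E' γ)⁻¹ * E' δ).1 w = w := by
        change (E' γ).1⁻¹ ((E' δ).1 w) = w
        have h : (E' γ).1 w = (E' δ).1 w := h
        rw [← h, IsometryEquiv.inv_apply_self]
      have h2 := deckGroup_free hp ((E' γ)⁻¹ * E' δ).2 h1
      exact inv_mul_eq_one.1 (Subtype.ext h2)
    · intro γ hγ
      refine ⟨(E' γ).2.2 w, ?_⟩
      rw [Metric.mem_closedBall, dist_comm]
      exact hγ
  · intro w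
    obtain ⟨R, hR⟩ : ∃ R : ℕ, Set.univ ⊆ p '' Metric.ball w R := by
      refine isCompact_univ.elim_directed_cover (fun n : ℕ => p '' Metric.ball w n)
        (fun n => hp.isOpenMap _ Metric.isOpen_ball) ?_ ?_
      · intro x _
        obtain ⟨z, rfl⟩ := hs x
        obtain ⟨n, hn⟩ := exists_nat_gt (dist z w)
        exact Set.mem_iUnion.2 ⟨n, z, hn, rfl⟩
      · intro n m
        refine ⟨max n m, Set.image_mono (Metric.ball_subset_ball (by simp)),
          Set.image_mono (Metric.ball_subset_ball (by simp))⟩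
    refine ⟨R, fun z => ?_⟩
    obtain ⟨u, hu, huz⟩ := hR (Set.mem_univ (p z))
    obtain ⟨A, hA, hpA⟩ := hd u z huz
    obtain ⟨γ, hγ⟩ := E'.surjective ⟨IsometryEquiv.constSMul A, ⟨A, fun z => rfl⟩, hpA⟩
    refine ⟨γ, ?_⟩
    change dist z ((E' γ).1 w) ≤ R
    rw [hγ]
    change dist z (A • w) ≤ R
    rw [← hA, dist_smul]
    exact (Metric.mem_ball.1 hu).le

end Parabolic

namespace Parabolic

open Filter Topology

/-! ### One-endedness -/

theorem isPreconnected_of_convex {K : Set ℂ} (hK : Convex ℝ K) :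
    IsPreconnected {z : ℍ | (z : ℂ) ∈ K} := by
  rw [← UpperHalfPlane.isEmbedding_coe.isInducing.isPreconnected_image]
  have : UpperHalfPlane.coe '' {z : ℍ | (z : ℂ) ∈ K} = K ∩ {z : ℂ | 0 < z.im} := by
    ext z
    constructor
    · rintro ⟨u, hu, rfl⟩
      exact ⟨hu, u.im_pos⟩
    · rintro ⟨h1, h2⟩
      exact ⟨⟨z, h2⟩, h1, rfl⟩
  rw [this]
  exact (hK.inter (convex_halfSpace_im_gt 0)).isPreconnected

/-- A box in the upper half-plane. -/
def box (n : ℝ) : Set ℍ := {z | |z.re| ≤ n ∧ n⁻¹ ≤ z.im ∧ z.im ≤ n}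

/-- The complement is a chain of four overlapping convex regions. As boxes exhaust `ℍ`, this is the
one-endedness of `ℍ` itself. -/
theorem isPreconnected_compl_box {n : ℝ} (hn : 0 < n) : IsPreconnected (box n)ᶜ := by
  have h1 : IsPreconnected {z : ℍ | n < z.im} := isPreconnected_of_convex (convex_halfSpace_im_gt n)
  have h2 : IsPreconnected {z : ℍ | n < z.re} := isPreconnected_of_convex (convex_halfSpace_re_gt n)
  have h3 : IsPreconnected {z : ℍ | z.re < -n} :=
    isPreconnected_of_convex (convex_halfSpace_re_lt (-n))
  have h4 : IsPreconnected {z : ℍ | z.im < n⁻¹} :=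
    isPreconnected_of_convex (convex_halfSpace_im_lt n⁻¹)
  have h12 := h1.union ⟨⟨n + 1, n + 1⟩, by positivity⟩ (by change n < n + 1; linarith)
    (by change n < n + 1; linarith) h2
  have h123 := h12.union ⟨⟨-n - 1, n + 1⟩, by positivity⟩
    (Set.mem_union_left _ (by change n < n + 1; linarith))
    (by change -n - 1 < -n; linarith) h3
  have h1234 := h123.union ⟨⟨n + 1, n⁻¹ / 2⟩, by positivity⟩
    (Set.mem_union_left _ (Set.mem_union_right _ (by change n < n + 1; linarith)))
    (by change n⁻¹ / 2 < n⁻¹; linarith [inv_pos.2 hn]) h4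
  convert h1234 using 1
  ext z
  simp only [box, Set.mem_compl_iff, Set.mem_ofPred_eq, Set.mem_union, abs_le]
  constructor
  · intro h
    by_contra! h'
    exact h ⟨⟨by linarith, by linarith⟩, by linarith, by linarith⟩
  · rintro h ⟨⟨h1, h2⟩, h3, h4⟩
    rcases h with ((h | h) | h) | h <;> linarith

theorem abs_re_sub_le (z w : ℍ) : |z.re - w.re| ≤ w.im * (Real.exp (dist z w) - 1) := by
  refine le_trans ?_ (UpperHalfPlane.dist_coe_le z w)
  rw [Complex.dist_eq]
  exact Complex.abs_re_le_norm (z - w : ℂ)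

theorem exists_closedBall_subset_box (w : ℍ) (R : ℝ) :
    ∃ n, 0 < n ∧ Metric.closedBall w R ⊆ box n := by
  have hw := w.im_pos
  have hE := Real.exp_pos R
  have h2 : 0 < w.im / Real.exp R := by positivity
  refine ⟨|w.re| + w.im * Real.exp R + (w.im / Real.exp R)⁻¹, by positivity, fun z hz => ?_⟩
  rw [Metric.mem_closedBall] at hz
  have hz' : Real.exp (dist z w) ≤ Real.exp R := Real.exp_le_exp.2 hz
  have h3 : 0 < (w.im / Real.exp R)⁻¹ := by positivity
  have h4 : 0 ≤ |w.re| := abs_nonneg _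
  have h5 : 0 < w.im * Real.exp R := by positivity
  refine ⟨?_, ?_, ?_⟩
  · have h6 := abs_re_sub_le z w
    have h7 : w.im * (Real.exp (dist z w) - 1) ≤ w.im * Real.exp R := by gcongr; linarith
    have h8 : |z.re| ≤ |z.re - w.re| + |w.re| := by
      simpa using abs_add_le (z.re - w.re) w.re
    linarith
  · rw [inv_le_comm₀ (by positivity) z.im_pos]
    have h6 := UpperHalfPlane.im_div_exp_dist_le w z
    rw [dist_comm] at h6
    have h7 : w.im / Real.exp R ≤ z.im := le_trans (by gcongr) h6
    have : (z.im)⁻¹ ≤ (w.im / Real.exp R)⁻¹ := by gcongr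
    linarith
  · have h6 := UpperHalfPlane.im_le_im_mul_exp_dist z w
    have h7 : w.im * Real.exp (dist z w) ≤ w.im * Real.exp R := by gcongr
    linarith

/-- A group acting properly and coboundedly on `ℍ` is one-ended: every almost invariant subset is
finite or cofinite. -/
theorem finite_or_finite_compl {Γ : Type*} [Group Γ] {k : Γ →* (ℍ ≃ᵢ ℍ)}
    (hk : IsMetricallyProper k) (hc : IsCobounded k) {A : Set Γ}
    (hA : ∀ b : Γ, {a | a ∈ A ∧ a * b ∉ A}.Finite) : A.Finite ∨ Aᶜ.Finite := by
  set w : ℍ := UpperHalfPlane.I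
  obtain ⟨R, hR⟩ := hc w
  -- `U` and `V` are open and cover `ℍ`. A point in both is near `k a w` and `k (a * b) w` with `a ∈
  -- A`, `a * b ∉ A` and `b` in a finite set, so `a` lies in the finite set `F`. Thus `U ∩ V` is
  -- bounded, and outside a large box connectedness leaves only one of them.
  set U : Set ℍ := ⋃ a ∈ A, Metric.ball (k a w) (R + 1) with hU
  set V : Set ℍ := ⋃ a ∈ Aᶜ, Metric.ball (k a w) (R + 1) with hV
  have hUo : IsOpen U := isOpen_biUnion fun _ _ => Metric.isOpen_ball
  have hVo : IsOpen V := isOpen_biUnion fun _ _ => Metric.isOpen_ball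
  have hUV : ∀ z, z ∈ U ∪ V := by
    intro z
    obtain ⟨γ, hγ⟩ := hR z
    have hb : z ∈ Metric.ball (k γ w) (R + 1) := by rw [Metric.mem_ball]; linarith
    by_cases h : γ ∈ A
    · exact Or.inl (Set.mem_biUnion h hb)
    · exact Or.inr (Set.mem_biUnion (show γ ∈ Aᶜ from h) hb)
  set F : Set Γ := ⋃ b ∈ {b : Γ | dist w (k b w) ≤ 2 * (R + 1)}, {a | a ∈ A ∧ a * b ∉ A} with hF
  have hFf : F.Finite := (hk w w (2 * (R + 1))).biUnion fun b _ => hA b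
  obtain ⟨Q, hQ⟩ : ∃ Q, ∀ a ∈ F, dist (k a w) w ≤ Q := by
    obtain ⟨Q, hQ⟩ := (hFf.image fun a => dist (k a w) w).bddAbove
    exact ⟨Q, fun a ha => hQ ⟨a, ha, rfl⟩⟩
  obtain ⟨n, hn, hbox⟩ := exists_closedBall_subset_box w (Q + (R + 1))
  have hdisj : (box n)ᶜ ∩ (U ∩ V) = ∅ := by
    rw [Set.eq_empty_iff_forall_notMem]
    rintro z ⟨hz, hzU, hzV⟩
    obtain ⟨a, ha, hza⟩ := Set.mem_iUnion₂.1 hzU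
    obtain ⟨a', ha', hza'⟩ := Set.mem_iUnion₂.1 hzV
    rw [Metric.mem_ball] at hza hza'
    apply hz
    apply hbox
    rw [Metric.mem_closedBall]
    have haF : a ∈ F := by
      refine Set.mem_biUnion (x := a⁻¹ * a') ?_ ⟨ha, by simpa using ha'⟩
      change dist w (k (a⁻¹ * a') w) ≤ _
      rw [← (k a).dist_eq, ← IsometryEquiv.mul_apply, ← map_mul, mul_inv_cancel_left]
      linarith [dist_triangle_left (k a w) (k a' w) z]
    linarith [hQ a haF, dist_triangle z (k a w) w]
  have hfin : ∀ B : Set Γ, (∀ a ∈ B, k a w ∈ box n) → B.Finite := by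
    intro B hB
    have hb : Bornology.IsBounded (box n) := by
      rw [Metric.isBounded_iff_subset_closedBall ⟨⟨0, n⟩, hn⟩]
      refine ⟨(n ^ 2 + n ^ 2 + n ^ 2) / (2 * n⁻¹ * n), fun z hz => ?_⟩
      rw [Metric.mem_closedBall]
      have h1 := Real.self_le_sinh_iff.2 (dist_nonneg (x := z) (y := ⟨⟨0, n⟩, hn⟩))
      have h2 := (Real.sinh_lt_cosh (dist z ⟨⟨0, n⟩, hn⟩)).le
      refine (h1.trans h2).trans ?_
      rw [cosh_dist_eq]
      change ((z.re - 0) ^ 2 + z.im ^ 2 + n ^ 2) / (2 * z.im * n) ≤ _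
      obtain ⟨h3, h4, h5⟩ := hz
      have h6 : (z.re - 0) ^ 2 ≤ n ^ 2 := by rw [sub_zero]; exact sq_le_sq' (abs_le.1 h3).1 (abs_le.1 h3).2
      have h7 := z.im_pos
      have h8 : z.im ^ 2 ≤ n ^ 2 := by gcongr
      have := inv_pos.2 hn
      gcongr
    obtain ⟨r, hr⟩ := hb.subset_closedBall w
    refine (hk w w r).subset fun a ha => ?_
    have := hr (hB a ha)
    rw [Metric.mem_closedBall, dist_comm] at this
    exact this
  rcases (isPreconnected_iff_subset_of_disjoint.1 (isPreconnected_compl_box hn)) U V hUo hVo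
    (fun z _ => hUV z) hdisj with h | h
  · right
    apply hfin
    intro a ha
    by_contra hbx
    have h1 : k a w ∈ U := h hbx
    have h2 : k a w ∈ V := Set.mem_biUnion ha (Metric.mem_ball_self
      (by linarith [hR w, dist_nonneg.trans (hR w).choose_spec]))
    have : k a w ∈ (box n)ᶜ ∩ (U ∩ V) := ⟨hbx, h1, h2⟩
    rw [hdisj] at this
    exact this
  · left
    apply hfin
    intro a ha
    by_contra hbx
    have h1 : k a w ∈ V := h hbx
    have h2 : k a w ∈ U := Set.mem_biUnion ha (Metric.mem_ball_self
      (by linarith [hR w, dist_nonneg.trans (hR w).choose_spec]))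
    have : k a w ∈ (box n)ᶜ ∩ (U ∩ V) := ⟨hbx, h2, h1⟩
    rw [hdisj] at this
    exact this

/-! ### Horoballs and half-planes -/

theorem coe_SL_smul (A : SL(2, ℝ)) (z : ℍ) :
    ((A • z : ℍ) : ℂ) = ((A 0 0 : ℂ) * z + A 0 1) / ((A 1 0 : ℂ) * z + A 1 1) := by
  simpa using UpperHalfPlane.coe_specialLinearGroup_apply A z

theorem SL_det (A : SL(2, ℝ)) : A 0 0 * A 1 1 - A 0 1 * A 1 0 = 1 := by
  rw [← Matrix.det_fin_two]; exact A.2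

theorem SL_denom_ne_zero (A : SL(2, ℝ)) (z : ℍ) : (A 1 0 : ℂ) * z + A 1 1 ≠ 0 := by
  intro h
  have h1 := congrArg Complex.im h
  have h2 := congrArg Complex.re h
  simp at h1 h2
  have h3 := SL_det A
  rcases h1 with h1 | h1
  · simp [h1] at h2
    simp [h1, h2] at h3
  · exact z.im_ne_zero h1

theorem SL_im_smul (A : SL(2, ℝ)) (z : ℍ) :
    (A • z).im * Complex.normSq ((A 1 0 : ℂ) * z + A 1 1) = z.im := by
  rw [← UpperHalfPlane.coe_im, coe_SL_smul, Complex.div_im, ← sub_div,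
    div_mul_cancel₀ _ (Complex.normSq_pos.2 (SL_denom_ne_zero A z)).ne']
  simp
  linear_combination z.im * SL_det A

/-- From `A z - a/c = -1 / (c (c z + d))`. It says that `A` carries horoballs at `∞` to horoballs at
`A ∞ = a/c`. -/
theorem SL_horoball (A : SL(2, ℝ)) (hc : A 1 0 ≠ 0) (z : ℍ) :
    A 1 0 ^ 2 * (((A • z).re - A 0 0 / A 1 0) ^ 2 + (A • z).im ^ 2) * z.im = (A • z).im := by
  have h0 := SL_denom_ne_zero A z
  have h1 := Complex.normSq_pos.2 h0
  have h2 := SL_im_smul A z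
  have hc' : (A 1 0 : ℂ) ≠ 0 := by exact_mod_cast hc
  have h3 : ((A • z : ℍ) : ℂ) - ((A 0 0 / A 1 0 : ℝ) : ℂ) =
      -1 / ((A 1 0 : ℂ) * ((A 1 0 : ℂ) * z + A 1 1)) := by
    rw [coe_SL_smul]
    push_cast
    have := SL_det A
    have h : (A 0 0 * A 1 1 - A 0 1 * A 1 0 : ℂ) = 1 := by exact_mod_cast this
    rw [div_sub_div _ _ h0 hc', div_eq_div_iff (mul_ne_zero h0 hc') (mul_ne_zero hc' h0)]
    linear_combination (-(A 1 0 : ℂ) * ((A 1 0 : ℂ) * z + A 1 1)) * h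
  have h4 := congrArg Complex.normSq h3
  rw [Complex.normSq_div, Complex.normSq_neg, Complex.normSq_one, Complex.normSq_mul,
    Complex.normSq_ofReal] at h4
  rw [Complex.normSq_apply] at h4
  simp only [Complex.sub_re, Complex.sub_im, Complex.ofReal_re, Complex.ofReal_im, sub_zero,
    UpperHalfPlane.coe_re, UpperHalfPlane.coe_im] at h4
  have h5 : A 1 0 ^ 2 * (((A • z).re - A 0 0 / A 1 0) ^ 2 + (A • z).im ^ 2) *
      Complex.normSq ((A 1 0 : ℂ) * z + A 1 1) = 1 := by
    rw [show ((A • z).re - A 0 0 / A 1 0) ^ 2 + (A • z).im ^ 2 =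
      1 / (A 1 0 * A 1 0 * Complex.normSq ((A 1 0 : ℂ) * z + A 1 1)) by rw [← h4]; ring]
    field_simp
  calc _ = A 1 0 ^ 2 * (((A • z).re - A 0 0 / A 1 0) ^ 2 + (A • z).im ^ 2) *
      ((A • z).im * Complex.normSq ((A 1 0 : ℂ) * z + A 1 1)) := by rw [h2]
    _ = (A • z).im * (A 1 0 ^ 2 * (((A • z).re - A 0 0 / A 1 0) ^ 2 + (A • z).im ^ 2) *
      Complex.normSq ((A 1 0 : ℂ) * z + A 1 1)) := by ring
    _ = _ := by rw [h5, mul_one]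

section HalfPlanes

variable {Γ : Type*} [Group Γ] {k j : Γ →* (ℍ ≃ᵢ ℍ)}

/-- Cones with vertex a point at infinity that is the centre of a horoball avoided by the orbit
contain only finitely many points of the orbit, if these have bounded height. -/
theorem finite_cone (hj : IsMetricallyProper j) {w : ℍ} {Y : ℝ} (hY : ∀ γ, (j γ w).im ≤ Y)
    {γ : Γ} {A : SL(2, ℝ)} (hA : ∀ z, j γ z = A • z) (hc : A 1 0 ≠ 0) (C : ℝ) :
    {δ | |(j δ w).re - A 0 0 / A 1 0| ≤ C * (j δ w).im}.Finite := by
  set x := A 0 0 / A 1 0 with hx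
  have hY0 : 0 < Y := (j 1 w).im_pos.trans_le (hY 1)
  -- In the cone, avoiding the horoball at `x` forces height at least `e`, and avoiding the one at
  -- `∞` forces height at most `Y`. What remains is a bounded region.
  set e := (A 1 0 ^ 2 * Y * (C ^ 2 + 1))⁻¹ with he
  have he0 : 0 < e := by positivity
  refine (hj ⟨⟨x, Y⟩, hY0⟩ w ((C ^ 2 * Y ^ 2 + Y ^ 2 + Y ^ 2) / (2 * Y * e))).subset
    fun δ hδ => ?_
  set u := j δ w with hu
  have hu0 := u.im_pos
  have hδ : |u.re - x| ≤ C * u.im := hδ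
  have h1 : (u.re - x) ^ 2 ≤ C ^ 2 * u.im ^ 2 := by
    rw [← mul_pow]
    exact sq_le_sq' (by linarith [(abs_le.1 hδ).1]) (abs_le.1 hδ).2
  have h2 : u = A • (j (γ⁻¹ * δ) w) := by
    rw [← hA, ← IsometryEquiv.mul_apply, ← map_mul, mul_inv_cancel_left]
  have h3 := SL_horoball A hc (j (γ⁻¹ * δ) w)
  rw [← h2] at h3
  have h4 : u.im ≤ A 1 0 ^ 2 * (C ^ 2 * u.im ^ 2 + u.im ^ 2) * Y := by
    calc u.im = A 1 0 ^ 2 * ((u.re - x) ^ 2 + u.im ^ 2) * (j (γ⁻¹ * δ) w).im := h3.symm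
      _ ≤ A 1 0 ^ 2 * (C ^ 2 * u.im ^ 2 + u.im ^ 2) * Y := by
        gcongr
        exact hY _
  have h5 : e ≤ u.im := by
    rw [he, inv_le_iff_one_le_mul₀ (by positivity)]
    refine le_of_mul_le_mul_right ?_ hu0
    linarith
  have h6 : u.im ≤ Y := hY δ
  change dist _ u ≤ _
  have h7 := Real.self_le_sinh_iff.2 (dist_nonneg (x := (⟨⟨x, Y⟩, hY0⟩ : ℍ)) (y := u))
  refine (h7.trans (Real.sinh_lt_cosh _).le).trans ?_
  rw [cosh_dist_eq]
  change ((x - u.re) ^ 2 + Y ^ 2 + u.im ^ 2) / (2 * Y * u.im) ≤ _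
  have h8 : (x - u.re) ^ 2 ≤ C ^ 2 * Y ^ 2 := by
    calc (x - u.re) ^ 2 = (u.re - x) ^ 2 := by ring
      _ ≤ C ^ 2 * u.im ^ 2 := h1
      _ ≤ C ^ 2 * Y ^ 2 := by gcongr
  have h9 : u.im ^ 2 ≤ Y ^ 2 := by gcongr
  gcongr

/-- If right multiplication by `b` takes `δ` across the vertical geodesic, the orbit point of `δ` is
within `dist w (j b w)` of it, hence in a cone with finitely many orbit points. The half-plane is
thus almost invariant. -/
theorem finite_half_plane (hk : IsMetricallyProper k) (hkc : IsCobounded k)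
    (hj : IsMetricallyProper j) {w : ℍ} {Y : ℝ} (hY : ∀ γ, (j γ w).im ≤ Y)
    {γ : Γ} {A : SL(2, ℝ)} (hA : ∀ z, j γ z = A • z) (hc : A 1 0 ≠ 0) :
    {δ | A 0 0 / A 1 0 < (j δ w).re}.Finite ∨ {δ | A 0 0 / A 1 0 < (j δ w).re}ᶜ.Finite := by
  apply finite_or_finite_compl hk hkc
  intro b
  refine (finite_cone hj hY hA hc (Real.exp (dist w (j b w)) - 1)).subset ?_
  rintro δ ⟨h1, h2⟩
  have h1 : A 0 0 / A 1 0 < (j δ w).re := h1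
  have h2 : ¬ A 0 0 / A 1 0 < (j (δ * b) w).re := h2
  have h3 := abs_re_sub_le (j (δ * b) w) (j δ w)
  rw [map_mul, IsometryEquiv.mul_apply, (j δ).dist_eq, dist_comm] at h3
  rw [map_mul, IsometryEquiv.mul_apply] at h2
  change |(j δ w).re - A 0 0 / A 1 0| ≤ _
  rw [abs_of_nonneg (by linarith), mul_comm]
  rw [abs_of_nonpos (by linarith)] at h3
  linarith

end HalfPlanes

end Parabolic

namespace Parabolic

open Filter Topology

/-! ### Möbius conjugation and horoballs avoided by an orbit -/

theorem exists_dist_gt (R : ℝ) : ∃ z : ℍ, R < dist z UpperHalfPlane.I := by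
  refine ⟨⟨⟨0, Real.exp (R + 1)⟩, Real.exp_pos _⟩, lt_of_lt_of_le ?_
    (UpperHalfPlane.dist_log_im_le _ _)⟩
  rw [UpperHalfPlane.I_im, Real.log_one]
  change R < dist (Real.log (Real.exp (R + 1))) 0
  rw [Real.log_exp, Real.dist_eq, sub_zero]
  linarith [le_abs_self (R + 1)]

section Fixed

variable {Γ : Type*} [Group Γ] {k j : Γ →* (ℍ ≃ᵢ ℍ)}

/-- Points of `ℍ` that leave every compact subset of `ℍ` but stay bounded in `ℂ` accumulate to a
real number. -/
theorem exists_real_limit {q : ℕ → ℍ} {w : ℍ} {B : ℝ} (hq : ∀ n : ℕ, n < dist (q n) w)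
    (hB : ∀ n, ‖(q n : ℂ)‖ ≤ B) :
    ∃ t : ℝ, ∃ φ : ℕ → ℕ, StrictMono φ ∧ Tendsto (fun n => (q (φ n) : ℂ)) atTop (𝓝 t) := by
  obtain ⟨t, -, φ, hφ, ht⟩ := tendsto_subseq_of_bounded (x := fun n => (q n : ℂ))
    (Metric.isBounded_closedBall (x := (0 : ℂ)) (r := B)) (fun n => by simpa using hB n)
  have h0 : 0 ≤ t.im := ge_of_tendsto' ((Complex.continuous_im.tendsto t).comp ht)
    fun n => (q (φ n)).im_pos.le
  rcases h0.eq_or_lt with h0 | h0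
  · refine ⟨t.re, φ, hφ, ?_⟩
    rwa [show ((t.re : ℝ) : ℂ) = t from Complex.ext (by simp) (by simpa using h0)]
  · exfalso
    set u : ℍ := ⟨t, h0⟩
    have h1 : Tendsto (fun n => q (φ n)) atTop (𝓝 u) :=
      UpperHalfPlane.isEmbedding_coe.tendsto_nhds_iff.2 ht
    have h2 : Tendsto (fun n => dist (q (φ n)) w) atTop (𝓝 (dist u w)) := h1.dist tendsto_const_nhds
    have h3 : Tendsto (fun n => dist (q (φ n)) w) atTop atTop :=
      tendsto_atTop_mono (fun n => (hq (φ n)).le) (tendsto_natCast_atTop_atTop.comp hφ.tendsto_atTop)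
    exact not_tendsto_nhds_of_tendsto_atTop h3 _ h2

/-- The conjugate of an action on `ℍ` by a Möbius transformation. -/
noncomputable def conjAction (A : SL(2, ℝ)) (j : Γ →* (ℍ ≃ᵢ ℍ)) : Γ →* (ℍ ≃ᵢ ℍ) :=
  (MulAut.conj (IsometryEquiv.constSMul A)).toMonoidHom.comp j

theorem conjAction_apply (A : SL(2, ℝ)) (j : Γ →* (ℍ ≃ᵢ ℍ)) (γ : Γ) (z : ℍ) :
    conjAction A j γ z = A • j γ (A⁻¹ • z) := rfl

theorem conjAction_smul (A : SL(2, ℝ)) (j : Γ →* (ℍ ≃ᵢ ℍ)) (γ : Γ) (z : ℍ) :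
    conjAction A j γ (A • z) = A • j γ z := by rw [conjAction_apply, inv_smul_smul]

theorem IsMetricallyProper.conj (hj : IsMetricallyProper j) (A : SL(2, ℝ)) :
    IsMetricallyProper (conjAction A j) := by
  intro z w R
  refine (hj (A⁻¹ • z) (A⁻¹ • w) R).subset fun γ hγ => ?_
  have hγ : dist z (conjAction A j γ w) ≤ R := hγ
  rw [conjAction_apply] at hγ
  change dist (A⁻¹ • z) _ ≤ R
  rwa [← dist_smul A, smul_inv_smul]

theorem ActsBySL.conj_apply (A : SL(2, ℝ)) {γ : Γ} {B : SL(2, ℝ)} (hB : ∀ z, j γ z = B • z) (z : ℍ) :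
    conjAction A j γ z = (A * B * A⁻¹) • z := by
  rw [conjAction_apply, hB, mul_smul, mul_smul]

theorem ActsBySL.conj (hj : ActsBySL j) (A : SL(2, ℝ)) : ActsBySL (conjAction A j) := fun γ => by
  obtain ⟨B, hB⟩ := hj γ
  exact ⟨A * B * A⁻¹, ActsBySL.conj_apply A hB⟩

theorem injective_conjAction (hj : Function.Injective j) (A : SL(2, ℝ)) :
    Function.Injective (conjAction A j) :=
  (MulAut.conj (IsometryEquiv.constSMul A : ℍ ≃ᵢ ℍ)).injective.comp hj

/-- The Möbius transformation `z ↦ -1 / (z - t)`. -/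
def toInfinity (t : ℝ) : SL(2, ℝ) := ⟨!![0, -1; 1, -t], by simp [Matrix.det_fin_two]⟩

theorem coe_toInfinity_smul (t : ℝ) (z : ℍ) : ((toInfinity t • z : ℍ) : ℂ) = -1 / ((z : ℂ) - t) := by
  rw [coe_SL_smul]
  simp [toInfinity, sub_eq_add_neg]

theorem norm_toInfinity_smul (t : ℝ) (z : ℍ) :
    ‖((toInfinity t • z : ℍ) : ℂ)‖ = ‖(z : ℂ) - t‖⁻¹ := by
  rw [coe_toInfinity_smul, norm_div]; simp

/-- If points `q n` tend to infinity in `ℂ` and are closer to `w` than to `u`, then `u` is not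
higher than `w`. -/
theorem im_le_of_dist_le {q : ℕ → ℍ} {w u : ℍ} (hq : ∀ n, dist (q n) w ≤ dist (q n) u)
    (hB : ∀ B : ℝ, ∃ n, B < ‖(q n : ℂ)‖) : u.im ≤ w.im := by
  by_contra! hlt
  have hw := w.im_pos
  have hu := u.im_pos
  set r := u.im - w.im with hr
  have hr0 : 0 < r := by linarith
  -- Clearing denominators in the `cosh` inequality yields `|q|² r ≤ E |q|` once `|q| ≥ 1`, which
  -- fails for `|q| > E / r`.
  set E := 2 * (|w.re| * u.im + |u.re| * w.im) + (u.re ^ 2 + u.im ^ 2) * w.im with hE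
  have hE0 : 0 ≤ E := by positivity
  obtain ⟨n, hn⟩ := hB (1 + E / r)
  have hn1 : 1 ≤ ‖(q n : ℂ)‖ := by have : 0 ≤ E / r := by positivity
                                   linarith
  have hnE : E < r * ‖(q n : ℂ)‖ := by
    have : E / r < ‖(q n : ℂ)‖ := by linarith
    rwa [div_lt_iff₀ hr0, mul_comm] at this
  have h1 := hq n
  rw [← abs_of_nonneg (dist_nonneg (x := q n) (y := w)), ← abs_of_nonneg (dist_nonneg (x := q n)
    (y := u)), ← Real.cosh_le_cosh, cosh_dist_eq, cosh_dist_eq] at h1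
  have hq0 := (q n).im_pos
  rw [div_le_div_iff₀ (by positivity) (by positivity)] at h1
  have h2 : (((q n).re - w.re) ^ 2 + (q n).im ^ 2 + w.im ^ 2) * u.im ≤
      (((q n).re - u.re) ^ 2 + (q n).im ^ 2 + u.im ^ 2) * w.im := by
    refine le_of_mul_le_mul_left ?_ (show 0 < 2 * (q n).im by positivity)
    linarith
  set N := ‖(q n : ℂ)‖ with hN
  have hN2 : N ^ 2 = (q n).re ^ 2 + (q n).im ^ 2 := by
    rw [hN, ← Complex.normSq_eq_norm_sq, Complex.normSq_apply]; simp [sq]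
  have hre : |(q n).re| ≤ N := Complex.abs_re_le_norm (q n : ℂ)
  have h3 : N ^ 2 * r ≤ 2 * ((q n).re * (w.re * u.im - u.re * w.im)) +
      (u.re ^ 2 + u.im ^ 2) * w.im := by
    have : 0 ≤ (w.re ^ 2 + w.im ^ 2) * u.im := by positivity
    rw [hN2, hr]
    linarith
  have h4 : (q n).re * (w.re * u.im - u.re * w.im) ≤ N * (|w.re| * u.im + |u.re| * w.im) := by
    refine (le_abs_self _).trans ?_
    rw [abs_mul]
    gcongr
    refine (abs_sub _ _).trans ?_
    rw [abs_mul, abs_mul, abs_of_pos hw, abs_of_pos hu]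
  have h5 : (u.re ^ 2 + u.im ^ 2) * w.im ≤ N * ((u.re ^ 2 + u.im ^ 2) * w.im) := by
    have : 0 ≤ (u.re ^ 2 + u.im ^ 2) * w.im := by positivity
    nlinarith
  have h6 : N ^ 2 * r ≤ N * E := by rw [hE]; linarith
  nlinarith

/-- If a proper action is not cobounded, then up to conjugation there is a horoball centred at `∞`
that avoids an orbit. -/
theorem exists_horoball (hj : IsMetricallyProper j) (hn : ¬ IsCobounded j) :
    ∃ (A : SL(2, ℝ)) (w : ℍ) (Y : ℝ), ∀ γ, (conjAction A j γ w).im ≤ Y := by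
  simp only [IsCobounded, not_forall, not_exists, not_le] at hn
  obtain ⟨w, hw⟩ := hn
  -- A point far from the orbit is translated so that `w` is its nearest orbit point. Seen from a
  -- boundary point where these `q n` accumulate, no orbit point is deeper than `w`; that boundary
  -- point, `∞` or a real `t`, is the centre of the horoball.
  have key : ∀ n : ℕ, ∃ q : ℍ, n < dist q w ∧ ∀ γ, dist q w ≤ dist q (j γ w) := by
    intro n
    obtain ⟨z, hz⟩ := hw n
    have hfin := hj z w (dist z w)
    obtain ⟨δ, hδ, hmin⟩ := hfin.exists_minimalFor (fun γ => dist z (j γ w)) _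
      ⟨1, show dist z (j 1 w) ≤ dist z w by simp⟩
    have hmin' : ∀ γ, dist z (j δ w) ≤ dist z (j γ w) := by
      intro γ
      by_cases h : dist z (j γ w) ≤ dist z w
      · rcases le_total (dist z (j δ w)) (dist z (j γ w)) with h' | h'
        · exact h'
        · exact hmin h h'
      · exact le_trans hδ (not_le.1 h).le
    have e : ∀ γ, dist (j δ⁻¹ z) (j γ w) = dist z (j (δ * γ) w) := by
      intro γ
      rw [← (j δ).dist_eq, ← IsometryEquiv.mul_apply, ← IsometryEquiv.mul_apply, ← map_mul,
        ← map_mul, mul_inv_cancel, map_one]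
      rfl
    have e1 : dist (j δ⁻¹ z) w = dist z (j δ w) := by
      have := e 1
      simpa using this
    refine ⟨j δ⁻¹ z, ?_, fun γ => ?_⟩
    · rw [e1]; exact hz δ
    · rw [e1, e]; exact hmin' _
  choose q hq1 hq2 using key
  by_cases hB : ∀ B : ℝ, ∃ n, B < ‖(q n : ℂ)‖
  · refine ⟨1, w, w.im, fun γ => ?_⟩
    rw [conjAction_apply]
    simp only [inv_one, one_smul]
    exact im_le_of_dist_le (fun n => hq2 n γ) hB
  · push Not at hB
    obtain ⟨B, hB⟩ := hB
    obtain ⟨t, φ, hφ, ht⟩ := exists_real_limit hq1 hB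
    refine ⟨toInfinity t, toInfinity t • w, (toInfinity t • w).im, fun γ => ?_⟩
    rw [conjAction_smul]
    refine im_le_of_dist_le (q := fun n => toInfinity t • q (φ n)) (fun n => ?_) fun B => ?_
    · rw [dist_smul, dist_smul]; exact hq2 _ γ
    · have h1 : Tendsto (fun n => ‖(q (φ n) : ℂ) - t‖) atTop (𝓝[>] 0) := by
        refine tendsto_nhdsWithin_iff.2 ⟨?_, Eventually.of_forall fun n => ?_⟩
        · simpa using (ht.sub_const (t : ℂ)).norm
        · exact norm_pos_iff.2 (sub_ne_zero.2 (UpperHalfPlane.ne_ofReal _ t))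
      obtain ⟨n, hn⟩ := (h1.inv_tendsto_nhdsGT_zero.eventually_gt_atTop B).exists
      exact ⟨n, by rw [norm_toInfinity_smul]; exact hn⟩

/-! ### Groups fixing a point at infinity -/

/-- A discrete group does not contain both a translation and a homothety of ratio `< 1` based
at `∞`. -/
theorem not_translation_of_contraction (hj : IsMetricallyProper j) {τ h : Γ} {b κ β : ℝ} (hb : b ≠ 0)
    (hτ : ∀ z, (j τ z : ℂ) = z + b) (hκ0 : 0 < κ) (hκ : κ < 1) (hh : ∀ z, (j h z : ℂ) = κ * z + β) :
    False := by
  -- Conjugating `τ` by powers of `h` gives infinitely many translations by arbitrarily small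
  -- amounts, against properness.
  have key : ∀ n : ℕ, ∃ σ : Γ, ∀ z, (j σ z : ℂ) = z + (κ ^ n * b : ℝ) := by
    intro n
    induction n with
    | zero => exact ⟨τ, fun z => by simp [hτ]⟩
    | succ n ih =>
      obtain ⟨σ, hσ⟩ := ih
      refine ⟨h * σ * h⁻¹, fun z => ?_⟩
      have h1 : (j h (j h⁻¹ z) : ℂ) = z := by
        rw [← IsometryEquiv.mul_apply, ← map_mul, mul_inv_cancel, map_one]; rfl
      rw [map_mul, map_mul, IsometryEquiv.mul_apply, IsometryEquiv.mul_apply, hh, hσ]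
      rw [hh] at h1
      push_cast
      linear_combination h1
  choose σ hσ using key
  have hinj : Function.Injective σ := by
    intro n m hnm
    have h1 := hσ n UpperHalfPlane.I
    rw [hnm, hσ m] at h1
    have h2 : κ ^ m * b = κ ^ n * b := by exact_mod_cast add_left_cancel h1
    exact ((pow_right_injective₀ hκ0 hκ.ne) (mul_right_cancel₀ hb h2)).symm
  refine Set.infinite_of_injective_forall_mem hinj (fun n => ?_)
    (hj UpperHalfPlane.I UpperHalfPlane.I ((b ^ 2 + 1 + 1) / 2))
  change dist _ _ ≤ _
  set u := j (σ n) UpperHalfPlane.I with hu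
  have h1 := hσ n UpperHalfPlane.I
  have hre : u.re = κ ^ n * b := by
    have := congrArg Complex.re h1
    rw [Complex.add_re, Complex.ofReal_re] at this
    simpa using this
  have him : u.im = 1 := by
    have := congrArg Complex.im h1
    rw [Complex.add_im, Complex.ofReal_im] at this
    simpa using this
  refine ((Real.self_le_sinh_iff.2 dist_nonneg).trans (Real.sinh_lt_cosh _).le).trans ?_
  rw [cosh_dist_eq, hre, him, UpperHalfPlane.I_re, UpperHalfPlane.I_im]
  have h2 : (κ ^ n * b) ^ 2 ≤ b ^ 2 := by
    rw [mul_pow]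
    have : (κ ^ n) ^ 2 ≤ 1 := pow_le_one₀ (by positivity) (pow_le_one₀ hκ0.le hκ.le)
    nlinarith [sq_nonneg b]
  have : (0 - κ ^ n * b) ^ 2 ≤ b ^ 2 := by rw [zero_sub, neg_sq]; exact h2
  norm_num
  linarith

theorem not_translation_of_homothety (hj : IsMetricallyProper j) {τ h : Γ} {b κ β : ℝ} (hb : b ≠ 0)
    (hτ : ∀ z, (j τ z : ℂ) = z + b) (hκ0 : 0 < κ) (hκ : κ ≠ 1) (hh : ∀ z, (j h z : ℂ) = κ * z + β) :
    False := by
  rcases lt_or_gt_of_ne hκ with h1 | h1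
  · exact not_translation_of_contraction hj hb hτ hκ0 h1 hh
  · refine not_translation_of_contraction hj (h := h⁻¹) (κ := κ⁻¹) (β := -κ⁻¹ * β) hb hτ
      (by positivity) (inv_lt_one_of_one_lt₀ h1) fun z => ?_
    have h2 : (j h (j h⁻¹ z) : ℂ) = z := by
      rw [← IsometryEquiv.mul_apply, ← map_mul, mul_inv_cancel, map_one]; rfl
    rw [hh] at h2
    have : (κ : ℂ) ≠ 0 := by exact_mod_cast hκ0.ne'
    rw [← h2]
    push_cast
    field_simp
    ring

/-- A discrete group fixing `∞` is abelian. -/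
theorem commute_of_fixes_infinity (hj : IsMetricallyProper j) (hinj : Function.Injective j)
    (h : ∀ γ, ∃ κ β : ℝ, 0 < κ ∧ ∀ z, (j γ z : ℂ) = κ * z + β) (γ δ : Γ) : γ * δ = δ * γ := by
  obtain ⟨κ, β, hκ, hγ⟩ := h γ
  obtain ⟨κ', β', hκ', hδ⟩ := h δ
  -- The ratios cancel in a commutator, leaving a translation. If it is nontrivial, discreteness
  -- forces `κ = κ' = 1`, and then it is trivial after all.
  have key : ∀ z, (j (γ * δ * (δ * γ)⁻¹) z : ℂ) = z + (κ * β' + β - κ' * β - β' : ℝ) := by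
    intro z
    have h1 : (j (δ * γ) (j (δ * γ)⁻¹ z) : ℂ) = z := by
      rw [← IsometryEquiv.mul_apply, ← map_mul, mul_inv_cancel, map_one]; rfl
    rw [map_mul, IsometryEquiv.mul_apply, map_mul, IsometryEquiv.mul_apply, hγ, hδ]
    rw [map_mul j δ, IsometryEquiv.mul_apply, hδ, hγ] at h1
    push_cast
    linear_combination h1
  by_cases hb : κ * β' + β - κ' * β - β' = 0
  · rw [← mul_inv_eq_one]
    apply hinj
    rw [map_one]
    ext1 z
    apply UpperHalfPlane.ext
    rw [key, hb]
    simp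
  · exfalso
    have e1 : κ = 1 := by
      by_contra hne
      exact not_translation_of_homothety hj hb key hκ hne hγ
    have e2 : κ' = 1 := by
      by_contra hne
      exact not_translation_of_homothety hj hb key hκ' hne hδ
    apply hb
    rw [e1, e2]
    ring

/-- An abelian group does not act coboundedly on `ℍ`. -/
theorem not_cobounded_of_commute (hk : ActsBySL k) (hkc : IsCobounded k)
    (h : ∀ γ δ : Γ, γ * δ = δ * γ) : False := by
  -- By commutativity the displacement of `γ` is constant on an orbit, and orbits are coarsely
  -- dense.
  have hdisp : ∀ γ, ∃ D, ∀ z, dist (k γ z) z ≤ D := by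
    intro γ
    obtain ⟨R, hR⟩ := hkc UpperHalfPlane.I
    refine ⟨R + dist (k γ UpperHalfPlane.I) UpperHalfPlane.I + R, fun z => ?_⟩
    obtain ⟨δ, hδ⟩ := hR z
    have h1 : dist (k γ (k δ UpperHalfPlane.I)) (k δ UpperHalfPlane.I) =
        dist (k γ UpperHalfPlane.I) UpperHalfPlane.I := by
      rw [← IsometryEquiv.mul_apply, ← map_mul, h, map_mul, IsometryEquiv.mul_apply,
        (k δ).dist_eq]
    have h2 := dist_triangle4 (k γ z) (k γ (k δ UpperHalfPlane.I)) (k δ UpperHalfPlane.I) z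
    rw [(k γ).dist_eq, h1] at h2
    linarith [dist_comm z (k δ UpperHalfPlane.I)]
  have htriv : ∀ γ z, k γ z = z := by
    intro γ
    obtain ⟨A, hA⟩ := hk γ
    obtain ⟨D, hD⟩ := hdisp γ
    -- At height `y`, displacement at most `D` means Euclidean displacement at most `y (e^D - 1)`.
    -- Letting `y → 0`, every real `x` is fixed, so the matrix is scalar.
    have hpol : ∀ x : ℝ, A 0 0 * x + A 0 1 - x * (A 1 0 * x + A 1 1) = 0 := by
      intro x
      have hy : Tendsto (fun n : ℕ => (1 : ℝ) / (n + 1)) atTop (𝓝 0) :=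
        tendsto_one_div_add_atTop_nhds_zero_nat
      have hz : Tendsto (fun n : ℕ => (x : ℂ) + ((1 / (n + 1) : ℝ) : ℂ) * Complex.I) atTop
          (𝓝 (x + ((0 : ℝ) : ℂ) * Complex.I)) :=
        (((Complex.continuous_ofReal.tendsto 0).comp hy).mul_const _).const_add _
      have key : ∀ n : ℕ, ‖(A 0 0 : ℂ) * (x + ((1 / (n + 1) : ℝ) : ℂ) * Complex.I) + A 0 1 -
          (x + ((1 / (n + 1) : ℝ) : ℂ) * Complex.I) *
          (A 1 0 * (x + ((1 / (n + 1) : ℝ) : ℂ) * Complex.I) + A 1 1)‖ ≤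
          (1 / (n + 1) : ℝ) * (Real.exp D - 1) *
            ‖A 1 0 * (x + ((1 / (n + 1) : ℝ) : ℂ) * Complex.I) + A 1 1‖ := by
        intro n
        have hpos : 0 < (1 / (n + 1) : ℝ) := by positivity
        set y : ℝ := 1 / (n + 1)
        set z : ℍ := ⟨x + (y : ℂ) * Complex.I, by simpa using hpos⟩ with hzdef
        have hzc : (z : ℂ) = x + (y : ℂ) * Complex.I := rfl
        have hzim : z.im = y := by change (x + (y : ℂ) * Complex.I).im = y; simp
        rw [← hzc]
        have h1 := UpperHalfPlane.dist_coe_le (A • z) z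
        have h2 : Real.exp (dist (A • z) z) ≤ Real.exp D := by
          rw [← hA]; exact Real.exp_le_exp.2 (hD z)
        have h0 := SL_denom_ne_zero A z
        have e : (A 0 0 : ℂ) * z + A 0 1 - z * (A 1 0 * z + A 1 1) =
            (((A • z : ℍ) : ℂ) - z) * (A 1 0 * z + A 1 1) := by
          rw [coe_SL_smul, sub_mul, div_mul_cancel₀ _ h0]
        rw [e, norm_mul]
        gcongr
        rw [← Complex.dist_eq]
        refine h1.trans ?_
        rw [hzim]
        gcongr
      have l1 := (((hz.const_mul (A 0 0 : ℂ)).add_const (A 0 1 : ℂ)).sub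
        (hz.mul ((hz.const_mul (A 1 0 : ℂ)).add_const (A 1 1 : ℂ)))).norm
      have l2 := (hy.mul_const (Real.exp D - 1)).mul
        ((hz.const_mul (A 1 0 : ℂ)).add_const (A 1 1 : ℂ)).norm
      have l3 := le_of_tendsto_of_tendsto' l1 l2 key
      simp only [Complex.ofReal_zero, zero_mul, add_zero] at l3
      have l4 := norm_le_zero_iff.1 l3
      exact_mod_cast l4
    have h0 := hpol 0
    have h1 := hpol 1
    have h2 := hpol (-1)
    have hb : A 0 1 = 0 := by linarith
    have hc : A 1 0 = 0 := by linarith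
    have hd : A 0 0 = A 1 1 := by linarith
    intro z
    apply UpperHalfPlane.ext
    have h3 := SL_denom_ne_zero A z
    rw [hA, coe_SL_smul, div_eq_iff h3, hb, hc, hd]
    simp
    ring
  obtain ⟨R, hR⟩ := hkc UpperHalfPlane.I
  obtain ⟨z, hz⟩ := exists_dist_gt R
  obtain ⟨γ, hγ⟩ := hR z
  rw [htriv] at hγ
  linarith

end Fixed

end Parabolic

namespace Parabolic

open Filter Topology

/-! ### Limit sets and cocompactness of discrete faithful representations -/

section Limit

variable {Γ : Type*} [Group Γ] {k j : Γ →* (ℍ ≃ᵢ ℍ)}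

/-- The real points of the limit set. -/
def realLimitSet (j : Γ →* (ℍ ≃ᵢ ℍ)) (w : ℍ) : Set ℝ :=
  {t | (t : ℂ) ∈ closure (Set.range fun γ : Γ => (j γ w : ℂ))}

theorem isClosed_realLimitSet (w : ℍ) : IsClosed (realLimitSet j w) :=
  isClosed_closure.preimage Complex.continuous_ofReal

/-- A real point is never an orbit point, so finitely many orbit points can be removed from a
neighbourhood of it. -/
theorem infinite_near_limit {w : ℍ} {t : ℝ} (ht : t ∈ realLimitSet j w) {U : Set ℂ} (hU : IsOpen U)
    (htU : (t : ℂ) ∈ U) : {γ | (j γ w : ℂ) ∈ U}.Infinite := by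
  intro hfin
  set P := (fun γ => (j γ w : ℂ)) '' {γ | (j γ w : ℂ) ∈ U} with hP
  have hPf : P.Finite := hfin.image _
  have htP : (t : ℂ) ∉ P := by
    rintro ⟨γ, -, h⟩
    exact UpperHalfPlane.ne_ofReal _ _ h
  obtain ⟨_, ⟨hu1, hu2⟩, γ, rfl⟩ := mem_closure_iff.1 ht (U ∩ Pᶜ) (hU.inter hPf.isClosed.isOpen_compl)
    ⟨htU, htP⟩
  exact hu2 ⟨γ, hu1, rfl⟩

/-- In a one-ended discrete group, the geodesic between two points at infinity that are centres of
horoballs avoided by the orbit does not separate the limit set. -/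
theorem not_separated (hk : IsMetricallyProper k) (hkc : IsCobounded k)
    (hj : IsMetricallyProper j) {w : ℍ} {Y : ℝ} (hY : ∀ γ, (j γ w).im ≤ Y)
    {γ : Γ} {A : SL(2, ℝ)} (hA : ∀ z, j γ z = A • z) (hc : A 1 0 ≠ 0) {s t : ℝ}
    (hs : s ∈ realLimitSet j w) (ht : t ∈ realLimitSet j w) (hsx : s < A 0 0 / A 1 0)
    (hxt : A 0 0 / A 1 0 < t) : False := by
  rcases finite_half_plane hk hkc hj hY hA hc with h | h
  · exact infinite_near_limit ht (isOpen_lt continuous_const Complex.continuous_re) hxt h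
  · refine infinite_near_limit hs (isOpen_lt Complex.continuous_re continuous_const) hsx
      (h.subset fun δ hδ => ?_)
    exact not_lt.2 (show (j δ w : ℂ).re < A 0 0 / A 1 0 from hδ).le

theorem SL_inv_entries (A : SL(2, ℝ)) :
    A⁻¹ 0 0 = A 1 1 ∧ A⁻¹ 0 1 = -A 0 1 ∧ A⁻¹ 1 0 = -A 1 0 ∧ A⁻¹ 1 1 = A 0 0 := by
  rw [Matrix.SpecialLinearGroup.SL2_inv_expl]
  simp

theorem apply_inv_eq {γ : Γ} {A : SL(2, ℝ)} (hA : ∀ z, j γ z = A • z) (z : ℍ) :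
    j γ⁻¹ z = A⁻¹ • z := by
  rw [eq_inv_smul_iff, ← hA, ← IsometryEquiv.mul_apply, ← map_mul, mul_inv_cancel, map_one]
  rfl

/-- The bound `|a z + b| ≤ B |c z + d|` holds on the orbit and passes to its closure. A zero of the
denominator would also be a zero of the numerator, against determinant 1. -/
theorem denom_ne_zero_of_mem_limit {w : ℍ} {B : ℝ} (hB : ∀ γ, ‖(j γ w : ℂ)‖ ≤ B) {γ : Γ}
    {A : SL(2, ℝ)} (hA : ∀ z, j γ z = A • z) {t : ℝ} (ht : t ∈ realLimitSet j w) :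
    A 1 0 * t + A 1 1 ≠ 0 := by
  intro h0
  have hcl : IsClosed {z : ℂ | ‖(A 0 0 : ℂ) * z + A 0 1‖ ≤ B * ‖(A 1 0 : ℂ) * z + A 1 1‖} :=
    isClosed_le (by fun_prop) (by fun_prop)
  have hsub : (Set.range fun δ : Γ => (j δ w : ℂ)) ⊆
      {z : ℂ | ‖(A 0 0 : ℂ) * z + A 0 1‖ ≤ B * ‖(A 1 0 : ℂ) * z + A 1 1‖} := by
    rintro _ ⟨δ, rfl⟩
    have h1 := hB (γ * δ)
    rw [map_mul, IsometryEquiv.mul_apply, hA, coe_SL_smul, norm_div,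
      div_le_iff₀ (norm_pos_iff.2 (SL_denom_ne_zero A _))] at h1
    exact h1
  have h1 := closure_minimal hsub hcl ht
  have h1 : ‖(A 0 0 : ℂ) * t + A 0 1‖ ≤ B * ‖(A 1 0 : ℂ) * t + A 1 1‖ := h1
  have h0' : (A 1 0 : ℂ) * t + A 1 1 = 0 := by exact_mod_cast h0
  rw [h0', norm_zero, mul_zero, norm_le_zero_iff] at h1
  have h2 : A 0 0 * t + A 0 1 = 0 := by exact_mod_cast h1
  have := SL_det A
  have e : (1 : ℝ) = 0 := by
    rw [← this]
    linear_combination (-A 1 0) * h2 + A 0 0 * h0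
  exact one_ne_zero e

theorem moebius_mem_limit {w : ℍ} {B : ℝ} (hB : ∀ γ, ‖(j γ w : ℂ)‖ ≤ B) {γ : Γ}
    {A : SL(2, ℝ)} (hA : ∀ z, j γ z = A • z) {t : ℝ} (ht : t ∈ realLimitSet j w) :
    (A 0 0 * t + A 0 1) / (A 1 0 * t + A 1 1) ∈ realLimitSet j w := by
  have h0 := denom_ne_zero_of_mem_limit hB hA ht
  have h0' : (A 1 0 : ℂ) * t + A 1 1 ≠ 0 := by exact_mod_cast h0
  have hcont : ContinuousAt (fun z : ℂ => ((A 0 0 : ℂ) * z + A 0 1) / ((A 1 0 : ℂ) * z + A 1 1)) t := by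
    fun_prop (disch := exact h0')
  have h1 := hcont.continuousWithinAt.mem_closure_image ht
  change (((A 0 0 * t + A 0 1) / (A 1 0 * t + A 1 1) : ℝ) : ℂ) ∈ closure _
  push_cast
  refine closure_mono ?_ h1
  rintro _ ⟨_, ⟨δ, rfl⟩, rfl⟩
  refine ⟨γ * δ, ?_⟩
  simp only [map_mul, IsometryEquiv.mul_apply, hA, coe_SL_smul]

theorem exists_dist_orbit_gt (hkc : IsCobounded k) (hj : IsMetricallyProper j) (w : ℍ) (R : ℝ) :
    ∃ γ, R < dist (j γ w) w := by
  by_contra! h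
  have hfin : (Set.univ : Set Γ).Finite := (hj w w R).subset fun γ _ => by
    change dist w (j γ w) ≤ R
    rw [dist_comm]
    exact h γ
  obtain ⟨Q, hQ⟩ := (hfin.image fun γ => dist (k γ UpperHalfPlane.I) UpperHalfPlane.I).bddAbove
  obtain ⟨r, hr⟩ := hkc UpperHalfPlane.I
  obtain ⟨z, hz⟩ := exists_dist_gt (r + Q)
  obtain ⟨γ, hγ⟩ := hr z
  have h1 : dist (k γ UpperHalfPlane.I) UpperHalfPlane.I ≤ Q := hQ ⟨γ, trivial, rfl⟩
  linarith [dist_triangle z (k γ UpperHalfPlane.I) UpperHalfPlane.I]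

/-- A one-ended discrete group whose orbits are bounded in `ℂ` fixes a real point. -/
theorem exists_fixed_point (hk : IsMetricallyProper k) (hkc : IsCobounded k)
    (hj : IsMetricallyProper j) {w : ℍ} {B : ℝ} (hB : ∀ γ, ‖(j γ w : ℂ)‖ ≤ B) :
    ∃ t : ℝ, ∀ (γ : Γ) (A : SL(2, ℝ)), (∀ z, j γ z = A • z) →
      A 0 0 * t + A 0 1 = t * (A 1 0 * t + A 1 1) := by
  have hY : ∀ γ, (j γ w).im ≤ B := fun γ =>
    (le_abs_self _).trans ((Complex.abs_im_le_norm (j γ w : ℂ)).trans (hB γ))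
  set Λ := realLimitSet j w with hΛ
  have hne : Λ.Nonempty := by
    choose γ hγ using fun n : ℕ => exists_dist_orbit_gt hkc hj w n
    obtain ⟨t, φ, -, ht⟩ := exists_real_limit hγ fun n => hB (γ n)
    exact ⟨t, mem_closure_of_tendsto ht (Eventually.of_forall fun n => ⟨_, rfl⟩)⟩
  have hbd : ∀ t ∈ Λ, |t| ≤ B := by
    intro t ht
    have h1 : closure (Set.range fun γ : Γ => (j γ w : ℂ)) ⊆ Metric.closedBall 0 B := by
      refine closure_minimal ?_ Metric.isClosed_closedBall
      rintro _ ⟨γ, rfl⟩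
      simpa using hB γ
    have h2 := h1 ht
    simpa using h2
  have hba : BddAbove Λ := ⟨B, fun t ht => (le_abs_self t).trans (hbd t ht)⟩
  have hmem : sSup Λ ∈ Λ := (isClosed_realLimitSet w).csSup_mem hne hba
  set l := sSup Λ with hl
  refine ⟨l, fun γ A hA => ?_⟩
  -- The pole of `A` is the image of `∞` under `γ⁻¹`, so it does not separate `Λ`. The denominator
  -- keeps its sign there and `A` is increasing on `Λ`.
  have hsep : ∀ s ∈ Λ, ∀ t ∈ Λ, s < t → 0 < (A 1 0 * s + A 1 1) * (A 1 0 * t + A 1 1) := by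
    intro s hs t ht hst
    have hs0 := denom_ne_zero_of_mem_limit hB hA hs
    have ht0 := denom_ne_zero_of_mem_limit hB hA ht
    by_contra hneg
    have hneg : (A 1 0 * s + A 1 1) * (A 1 0 * t + A 1 1) < 0 :=
      lt_of_le_of_ne (not_lt.1 hneg) (mul_ne_zero hs0 ht0)
    have hc : A 1 0 ≠ 0 := by
      intro hc
      rw [hc] at hneg
      nlinarith [sq_nonneg (A 1 1)]
    obtain ⟨e1, -, e3, -⟩ := SL_inv_entries A
    have hc2 : 0 < A 1 0 ^ 2 := by positivity
    have hprod : (s - A⁻¹ 0 0 / A⁻¹ 1 0) * (t - A⁻¹ 0 0 / A⁻¹ 1 0) < 0 := by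
      have : (A 1 0 * s + A 1 1) * (A 1 0 * t + A 1 1) =
          A 1 0 ^ 2 * ((s - A⁻¹ 0 0 / A⁻¹ 1 0) * (t - A⁻¹ 0 0 / A⁻¹ 1 0)) := by
        rw [e1, e3]; field_simp; ring
      rw [this] at hneg
      nlinarith
    have h1 : s - A⁻¹ 0 0 / A⁻¹ 1 0 < 0 ∧ 0 < t - A⁻¹ 0 0 / A⁻¹ 1 0 := by
      rcases mul_neg_iff.1 hprod with h | h
      · linarith [h.1, h.2]
      · exact h
    exact not_separated hk hkc hj hY (γ := γ⁻¹) (A := A⁻¹) (apply_inv_eq hA)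
      (by rw [e3]; exact neg_ne_zero.2 hc) hs ht (by linarith [h1.1]) (by linarith [h1.2])
  have hF := moebius_mem_limit hB hA hmem
  have hG := moebius_mem_limit hB (apply_inv_eq hA) hmem
  have hG0 := denom_ne_zero_of_mem_limit hB (apply_inv_eq hA) hmem
  have hl0 := denom_ne_zero_of_mem_limit hB hA hmem
  obtain ⟨e1, e2, e3, e4⟩ := SL_inv_entries A
  rw [e1, e2, e3, e4] at hG
  rw [e3, e4] at hG0
  -- `μ` is the preimage of the maximum `l`. If `μ < l`, monotonicity gives `l = A μ < A l`,
  -- although `A l ∈ Λ`.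
  set μ := (A 1 1 * l + -A 0 1) / (-A 1 0 * l + A 0 0) with hμ
  have hFμ : A 0 0 * μ + A 0 1 = l * (A 1 0 * μ + A 1 1) := by
    have hμN : μ * (-A 1 0 * l + A 0 0) = A 1 1 * l + -A 0 1 := by
      rw [hμ, div_mul_cancel₀ _ hG0]
    linear_combination hμN
  clear_value μ
  have hμl : μ ≤ l := le_csSup hba hG
  have hFl : (A 0 0 * l + A 0 1) / (A 1 0 * l + A 1 1) ≤ l := le_csSup hba hF
  rcases hμl.eq_or_lt with h | h
  · rw [h] at hFμ
    exact hFμ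
  · exfalso
    have h1 := hsep μ hG l hmem h
    have h2 : (A 0 0 * l + A 0 1) / (A 1 0 * l + A 1 1) - l =
        (l - μ) / ((A 1 0 * μ + A 1 1) * (A 1 0 * l + A 1 1)) := by
      have hμ0 := denom_ne_zero_of_mem_limit hB hA hG
      have hdet := SL_det A
      have e : l = (A 0 0 * μ + A 0 1) / (A 1 0 * μ + A 1 1) := by
        rw [eq_div_iff hμ0]; exact hFμ.symm
      rw [div_sub' hl0, div_eq_div_iff hl0 (mul_ne_zero hμ0 hl0)]
      linear_combination (A 1 0 * l + A 1 1) ^ 2 * hFμ + (A 1 0 * l + A 1 1) * (l - μ) * hdet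
    have h3 : 0 < (l - μ) / ((A 1 0 * μ + A 1 1) * (A 1 0 * l + A 1 1)) :=
      div_pos (by linarith) h1
    linarith

theorem fixes_infinity_of_entry {A : SL(2, ℝ)} (hc : A 1 0 = 0) :
    ∃ κ β : ℝ, 0 < κ ∧ ∀ z : ℍ, ((A • z : ℍ) : ℂ) = κ * z + β := by
  have hd := SL_det A
  rw [hc, mul_zero, sub_zero] at hd
  have h0 : A 0 0 ≠ 0 := left_ne_zero_of_mul_eq_one hd
  have h1 : A 1 1 ≠ 0 := right_ne_zero_of_mul_eq_one hd
  refine ⟨A 0 0 ^ 2, A 0 0 * A 0 1, by positivity, fun z => ?_⟩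
  have h1' : (A 1 1 : ℂ) ≠ 0 := by exact_mod_cast h1
  have hd' : (A 0 0 : ℂ) * A 1 1 = 1 := by exact_mod_cast hd
  rw [coe_SL_smul, hc]
  push_cast
  rw [zero_mul, zero_add, div_eq_iff h1']
  linear_combination (-(A 0 0 : ℂ) * z - A 0 1) * hd'

theorem conj_toInfinity_entry {A : SL(2, ℝ)} {t : ℝ}
    (h : A 0 0 * t + A 0 1 = t * (A 1 0 * t + A 1 1)) :
    (toInfinity t * A * (toInfinity t)⁻¹) 1 0 = 0 := by
  obtain ⟨e1, e2, e3, e4⟩ := SL_inv_entries (toInfinity t)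
  rw [Matrix.SpecialLinearGroup.coe_mul, Matrix.SpecialLinearGroup.coe_mul, Matrix.mul_apply,
    Fin.sum_univ_two, Matrix.mul_apply, Fin.sum_univ_two, Matrix.mul_apply, Fin.sum_univ_two,
    e1, e3]
  simp [toInfinity]
  linear_combination (-1 : ℝ) * h

/-- A discrete subgroup of `PSL(2, ℝ)` isomorphic to a cocompact one is cocompact. -/
theorem IsCobounded.of_proper (hkS : ActsBySL k) (hk : IsMetricallyProper k) (hkc : IsCobounded k)
    (hjS : ActsBySL j) (hj : IsMetricallyProper j) (hinj : Function.Injective j) :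
    IsCobounded j := by
  have hfix : ∀ {j : Γ →* (ℍ ≃ᵢ ℍ)}, ActsBySL j → IsMetricallyProper j → Function.Injective j →
      ¬ ∀ (γ : Γ) (A : SL(2, ℝ)), (∀ z, j γ z = A • z) → A 1 0 = 0 := by
    intro j hjS hj hinj h
    refine not_cobounded_of_commute hkS hkc (commute_of_fixes_infinity hj hinj fun γ => ?_)
    obtain ⟨A, hA⟩ := hjS γ
    obtain ⟨κ, β, hκ, hz⟩ := fixes_infinity_of_entry (h γ A hA)
    exact ⟨κ, β, hκ, fun z => by rw [hA, hz]⟩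
  have hbdd : ∀ {j : Γ →* (ℍ ≃ᵢ ℍ)}, ActsBySL j → IsMetricallyProper j → Function.Injective j →
      ∀ (w : ℍ) (B : ℝ), ¬ ∀ γ, ‖(j γ w : ℂ)‖ ≤ B := by
    intro j hjS hj hinj w B hB
    obtain ⟨t, ht⟩ := exists_fixed_point hk hkc hj hB
    refine hfix (hjS.conj (toInfinity t)) (hj.conj _) (injective_conjAction hinj _) ?_
    intro γ A hA
    have h1 : ∀ z, j γ z = ((toInfinity t)⁻¹ * A * toInfinity t) • z := by
      intro z
      rw [mul_smul, mul_smul, ← hA, conjAction_smul, inv_smul_smul]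
    have h2 := conj_toInfinity_entry (ht γ _ h1)
    rwa [show toInfinity t * ((toInfinity t)⁻¹ * A * toInfinity t) * (toInfinity t)⁻¹ = A by group]
      at h2
  by_contra hn
  obtain ⟨S, w, Y, hY⟩ := exists_horoball hj hn
  have hjS' := hjS.conj S
  have hj' := hj.conj S
  have hinj' := injective_conjAction hinj S
  set j' := conjAction S j
  -- If the limit set contains `ℝ`, any image `a/c` of `∞` would separate it, so `∞` is fixed.
  -- Otherwise a real point off the limit set is sent to `∞`, which makes the orbit bounded in `ℂ`.
  by_cases hall : ∀ t : ℝ, t ∈ realLimitSet j' w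
  · refine hfix hjS' hj' hinj' fun γ A hA => ?_
    by_contra hc
    exact not_separated hk hkc hj' hY hA hc (hall (A 0 0 / A 1 0 - 1)) (hall (A 0 0 / A 1 0 + 1))
      (by linarith) (by linarith)
  · push Not at hall
    obtain ⟨t, ht⟩ := hall
    obtain ⟨ε, hε, hball⟩ := Metric.isOpen_iff.1 isClosed_closure.isOpen_compl _ ht
    refine hbdd (hjS'.conj (toInfinity t)) (hj'.conj _) (injective_conjAction hinj' _)
      (toInfinity t • w) ε⁻¹ fun γ => ?_
    rw [conjAction_smul, norm_toInfinity_smul]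
    gcongr
    by_contra! hlt
    refine hball (show (j' γ w : ℂ) ∈ Metric.ball (t : ℂ) ε from ?_) (subset_closure ⟨γ, rfl⟩)
    rwa [Metric.mem_ball, Complex.dist_eq]

end Limit

end Parabolic

namespace Parabolic

open Filter Topology

/-! ### Isometries of the hyperbolic plane -/

/-- The reflection `z ↦ -conj z` of the upper half-plane. -/
def reflection (z : ℍ) : ℍ := ⟨⟨-z.re, z.im⟩, z.im_pos⟩

theorem reflection_re (z : ℍ) : (reflection z).re = -z.re := rfl

theorem reflection_im (z : ℍ) : (reflection z).im = z.im := rfl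

/-- The point `2i`. -/
def twoI : ℍ := ⟨⟨0, 2⟩, two_pos⟩

/-- The point `1 + i`. -/
def oneAddI : ℍ := ⟨⟨1, 1⟩, one_pos⟩

theorem eq_or_eq_reflection {z u : ℍ} (h1 : dist u UpperHalfPlane.I = dist z UpperHalfPlane.I)
    (h2 : dist u twoI = dist z twoI) : u = z ∨ u = reflection z := by
  have hz := z.im_pos
  have hu := u.im_pos
  have c1 := congrArg Real.cosh h1
  have c2 := congrArg Real.cosh h2
  rw [cosh_dist_eq, cosh_dist_eq, UpperHalfPlane.I_re, UpperHalfPlane.I_im,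
    div_eq_div_iff (by positivity) (by positivity)] at c1
  rw [cosh_dist_eq, cosh_dist_eq, show twoI.re = 0 from rfl, show twoI.im = 2 from rfl,
    div_eq_div_iff (by positivity) (by positivity)] at c2
  have him : u.im = z.im := by linarith
  have hre : u.re ^ 2 = z.re ^ 2 := by
    rw [him] at c1
    have : (2 * z.im) * u.re ^ 2 = (2 * z.im) * z.re ^ 2 := by linarith
    exact mul_left_cancel₀ (by positivity) this
  rcases sq_eq_sq_iff_eq_or_eq_neg.1 hre with h | h
  · exact Or.inl (UpperHalfPlane.ext_re_im h him)
  · exact Or.inr (UpperHalfPlane.ext_re_im h him)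

theorem re_eq_zero_of_dist_reflection {z : ℍ} (h : dist z oneAddI = dist z (reflection oneAddI)) :
    z.re = 0 := by
  have hz := z.im_pos
  have c := congrArg Real.cosh h
  rw [cosh_dist_eq, cosh_dist_eq, reflection_re, reflection_im, show oneAddI.re = 1 from rfl,
    show oneAddI.im = 1 from rfl, div_left_inj' (by positivity)] at c
  linarith

/-- Distances to `i` and `2i` determine a point up to reflection. The image of `1 + i`, which is off
the axis, decides the choice for all points at once. -/
theorem isometry_eq_of_fixes (g : ℍ ≃ᵢ ℍ) (h1 : g UpperHalfPlane.I = UpperHalfPlane.I)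
    (h2 : g twoI = twoI) : (∀ z, g z = z) ∨ ∀ z, g z = reflection z := by
  have key : ∀ z, g z = z ∨ g z = reflection z := fun z => by
    apply eq_or_eq_reflection
    · rw [← h1, g.dist_eq, h1]
    · rw [← h2, g.dist_eq, h2]
  have hrefl : ∀ z : ℍ, z.re = 0 → reflection z = z := fun z hz =>
    UpperHalfPlane.ext_re_im (by rw [reflection_re, hz, neg_zero]) rfl
  rcases key oneAddI with h | h
  · left
    intro z
    rcases key z with h' | h'
    · exact h'
    · have h3 := g.dist_eq z oneAddI
      rw [h, h'] at h3
      have h4 : dist z oneAddI = dist z (reflection oneAddI) := by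
        rw [← h3]
        apply eq_of_cosh_eq dist_nonneg dist_nonneg
        rw [cosh_dist_eq, cosh_dist_eq]
        simp only [reflection_re, reflection_im]
        ring
      rw [h', hrefl z (re_eq_zero_of_dist_reflection h4)]
  · right
    intro z
    rcases key z with h' | h'
    · have h3 := g.dist_eq z oneAddI
      rw [h, h'] at h3
      rw [h', hrefl z (re_eq_zero_of_dist_reflection h3.symm)]
    · exact h'

/-- The rotation of angle `2θ` about `i`. -/
noncomputable def rotation (θ : ℝ) : SL(2, ℝ) :=
  ⟨!![Real.cos θ, Real.sin θ; -Real.sin θ, Real.cos θ], by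
    rw [Matrix.det_fin_two]
    simp
    linarith [Real.sin_sq_add_cos_sq θ, sq (Real.sin θ), sq (Real.cos θ)]⟩

theorem exists_rotation (w : ℍ) : ∃ A : SL(2, ℝ), A • UpperHalfPlane.I = UpperHalfPlane.I ∧
    (A • w).re = 0 := by
  -- `f θ` is the numerator of the real part of `rotation θ • w`; it takes opposite values at `0`
  -- and `π / 2`.
  set f : ℝ → ℝ := fun θ => (w.re ^ 2 + w.im ^ 2 - 1) * (-(Real.sin θ * Real.cos θ)) +
    (Real.cos θ ^ 2 - Real.sin θ ^ 2) * w.re with hf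
  have hcont : Continuous f := by fun_prop
  have h0 : f 0 = w.re := by simp [hf]
  have h1 : f (Real.pi / 2) = -w.re := by simp [hf]
  obtain ⟨θ, hθ⟩ : ∃ θ, f θ = 0 := by
    have h2 : (0 : ℝ) ∈ Set.uIcc (f 0) (f (Real.pi / 2)) := by
      rw [h0, h1, Set.mem_uIcc]
      rcases le_total 0 w.re with h | h
      · right; constructor <;> linarith
      · left; constructor <;> linarith
    obtain ⟨θ, -, hθ⟩ := intermediate_value_uIcc hcont.continuousOn h2
    exact ⟨θ, hθ⟩
  have hsc := Real.sin_sq_add_cos_sq θ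
  refine ⟨rotation θ, ?_, ?_⟩
  · apply UpperHalfPlane.ext
    rw [coe_SL_smul, div_eq_iff (SL_denom_ne_zero _ _)]
    simp only [rotation, UpperHalfPlane.coe_I, Matrix.SpecialLinearGroup.coe_mk]
    simp
    linear_combination (Complex.sin θ) * Complex.I_sq
  · rw [← UpperHalfPlane.coe_re, coe_SL_smul, Complex.div_re, ← add_div, div_eq_zero_iff]
    left
    simp only [rotation, Matrix.SpecialLinearGroup.coe_mk]
    simp [hf, -Complex.ofReal_cos, -Complex.ofReal_sin] at hθ ⊢
    linear_combination hθ

theorem exists_SL_normalize (z w : ℍ) (h : dist z w = dist UpperHalfPlane.I twoI) :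
    ∃ A : SL(2, ℝ), A • z = UpperHalfPlane.I ∧ A • w = twoI := by
  obtain ⟨A, hA⟩ := MulAction.exists_smul_eq SL(2, ℝ) z UpperHalfPlane.I
  obtain ⟨B, hB, hBw⟩ := exists_rotation (A • w)
  set u := B • A • w with hu
  have hu0 := u.im_pos
  have hd : dist UpperHalfPlane.I u = dist UpperHalfPlane.I twoI := by
    rw [← h, hu, ← mul_smul, ← hB, ← hA, ← mul_smul, dist_smul]
  have hc := congrArg Real.cosh hd
  rw [cosh_dist_eq, cosh_dist_eq, UpperHalfPlane.I_re, UpperHalfPlane.I_im, hBw,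
    show twoI.re = 0 from rfl, show twoI.im = 2 from rfl,
    div_eq_div_iff (by positivity) (by positivity)] at hc
  -- Two points of the axis have this distance to `i`: `2i` and `i / 2`. In the second case `z ↦ -1
  -- / z` is applied as well.
  have hf : (u.im - 2) * (2 * u.im - 1) = 0 := by linarith
  rcases mul_eq_zero.1 hf with h1 | h1
  · refine ⟨B * A, by rw [mul_smul, hA, hB], ?_⟩
    rw [mul_smul]
    exact UpperHalfPlane.ext_re_im hBw (by change u.im = 2; linarith)
  · have hu2 : (u : ℂ) = ((1 / 2 : ℝ) : ℂ) * Complex.I := by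
      apply Complex.ext
      · simpa using hBw
      · have : u.im = 1 / 2 := by linarith
        simp [this]
    refine ⟨toInfinity 0 * B * A, ?_, ?_⟩
    · rw [mul_smul, mul_smul, hA, hB]
      apply UpperHalfPlane.ext
      rw [coe_toInfinity_smul]
      simp
    · rw [mul_smul, mul_smul, ← hu]
      apply UpperHalfPlane.ext
      have h2 : (twoI : ℂ) = 2 * Complex.I := by apply Complex.ext <;> simp [twoI]
      have h3 : ((1 / 2 : ℝ) : ℂ) * Complex.I - (0 : ℝ) ≠ 0 := by simp
      rw [coe_toInfinity_smul, hu2, h2, div_eq_iff h3]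
      push_cast
      linear_combination (-1 : ℂ) * Complex.I_sq

/-- Every isometry of the upper half-plane is a Möbius transformation, possibly composed with a
reflection. -/
theorem isometry_classification (g : ℍ ≃ᵢ ℍ) :
    ∃ A : SL(2, ℝ), (∀ z, g z = A • z) ∨ ∀ z, g z = A • reflection z := by
  obtain ⟨A, h1, h2⟩ := exists_SL_normalize (g UpperHalfPlane.I) (g twoI) (g.dist_eq _ _)
  refine ⟨A⁻¹, ?_⟩
  rcases isometry_eq_of_fixes (IsometryEquiv.constSMul A * g) h1 h2 with h | h
  · left
    intro z
    rw [eq_inv_smul_iff]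
    exact h z
  · right
    intro z
    rw [eq_inv_smul_iff]
    exact h z

/-! ### Fuchsian representations of surface groups are cocompact -/

section Fuchsian

variable {Γ : Type*} [Group Γ] {k j : Γ →* (ℍ ≃ᵢ ℍ)}

/-- Discreteness at the identity provides finitely many points and an `ε` such that only 1 moves all
of them by less than `ε`. For the `γ` in question, the images of these points lie in a compact
product of balls, so among infinitely many `γ` two would be `ε`-close there, hence equal. -/
theorem IsFuchsian.isMetricallyProper (hj : IsFuchsian j) : IsMetricallyProper j := by
  intro z w R
  obtain ⟨I, u, hu, hsub⟩ : ∃ (I : Finset ℍ) (u : ℍ → Set ℍ), (∀ a ∈ I, IsOpen (u a) ∧ a ∈ u a) ∧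
      ∀ γ : Γ, (∀ a ∈ I, j γ a ∈ u a) → γ = 1 := by
    have := hj.discrete
    obtain ⟨U, hU, hUeq⟩ := isOpen_induced_iff.1 (isOpen_discrete
      ({⟨fun z => j 1 z, ⟨1, rfl⟩⟩} : Set (Set.range fun γ : Γ => (j γ : ℍ → ℍ))))
    have h1 : (fun z => j 1 z) ∈ U := by
      have : (⟨fun z => j 1 z, ⟨1, rfl⟩⟩ : Set.range fun γ : Γ => (j γ : ℍ → ℍ)) ∈
          Subtype.val ⁻¹' U := by rw [hUeq]; rfl
      exact this
    obtain ⟨I, u, hu, hs⟩ := isOpen_pi_iff.1 hU _ h1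
    refine ⟨I, u, fun a ha => by simpa using hu a ha, fun γ hγ => ?_⟩
    have h2 : (fun z => j γ z) ∈ U := hs fun a ha => hγ a ha
    have h3 : (⟨fun z => j γ z, ⟨γ, rfl⟩⟩ : Set.range fun γ : Γ => (j γ : ℍ → ℍ)) ∈
        Subtype.val ⁻¹' U := h2
    rw [hUeq, Set.mem_singleton_iff] at h3
    apply hj.faithful
    ext1 x
    exact congrFun (congrArg Subtype.val h3) x
  have hopen : IsOpen (Set.univ.pi fun i : I => u i) :=
    isOpen_set_pi Set.finite_univ fun i _ => (hu i i.2).1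
  obtain ⟨ε, hε, hball⟩ := Metric.isOpen_iff.1 hopen (fun i : I => (i : ℍ)) fun i _ => (hu i i.2).2
  by_contra hinf
  have hinf : {γ | dist z (j γ w) ≤ R}.Infinite := hinf
  set K : Set (I → ℍ) := Set.univ.pi fun i : I => Metric.closedBall z (R + dist w i) with hK
  have hKc : IsCompact K := isCompact_univ_pi fun i => isCompact_closedBall _ _
  obtain ⟨t, -, htf, htc⟩ := hKc.finite_cover_balls (half_pos hε)
  have hmem : ∀ γ ∈ {γ | dist z (j γ w) ≤ R}, ∃ c ∈ t, (fun i : I => j γ i) ∈ Metric.ball c (ε / 2) := by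
    intro γ hγ
    have hγ : dist z (j γ w) ≤ R := hγ
    have h1 : (fun i : I => j γ i) ∈ K := by
      intro i _
      rw [Metric.mem_closedBall, dist_comm]
      have := dist_triangle z (j γ w) (j γ i)
      rw [(j γ).dist_eq] at this
      linarith
    obtain ⟨c, hc, h2⟩ := Set.mem_iUnion₂.1 (htc h1)
    exact ⟨c, hc, h2⟩
  choose! c hc hcb using hmem
  obtain ⟨γ, hγ, δ, hδ, hne, heq⟩ := hinf.exists_ne_map_eq_of_mapsTo (f := c) (fun γ hγ => hc γ hγ) htf
  apply hne
  have h1 : dist (fun i : I => j γ i) (fun i : I => j δ i) < ε := by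
    have h2 := hcb γ hγ
    have h3 := hcb δ hδ
    rw [heq, Metric.mem_ball] at h2
    rw [Metric.mem_ball] at h3
    linarith [dist_triangle_right (fun i : I => j γ i) (fun i : I => j δ i) (c δ)]
  have h4 : (fun i : I => j (γ⁻¹ * δ) i) ∈ Metric.ball (fun i : I => (i : ℍ)) ε := by
    rw [Metric.mem_ball, dist_comm]
    rw [dist_pi_lt_iff hε] at h1 ⊢
    intro i
    have h5 := h1 i
    rw [← (j γ).dist_eq, ← IsometryEquiv.mul_apply, ← map_mul, mul_inv_cancel_left]
    exact h5
  have h5 := hsub (γ⁻¹ * δ) fun a ha => hball h4 ⟨a, ha⟩ trivial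
  exact inv_mul_eq_one.1 h5

/-- The elements that act by orientation preserving isometries. -/
def orientationSubgroup (j : Γ →* (ℍ ≃ᵢ ℍ)) : Subgroup Γ where
  carrier := {γ | ∃ A : SL(2, ℝ), ∀ z, j γ z = A • z}
  one_mem' := ⟨1, fun z => by simp⟩
  mul_mem' := by
    rintro γ δ ⟨A, hA⟩ ⟨B, hB⟩
    exact ⟨A * B, fun z => by rw [map_mul, IsometryEquiv.mul_apply, hA, hB, mul_smul]⟩
  inv_mem' := by
    rintro γ ⟨A, hA⟩
    exact ⟨A⁻¹, fun z => apply_inv_eq hA z⟩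

theorem mul_inv_mem_orientationSubgroup {γ δ : Γ} (hγ : γ ∉ orientationSubgroup j)
    (hδ : δ ∉ orientationSubgroup j) : γ * δ⁻¹ ∈ orientationSubgroup j := by
  obtain ⟨A, hA | hA⟩ := isometry_classification (j γ)
  · exact absurd ⟨A, hA⟩ hγ
  obtain ⟨B, hB | hB⟩ := isometry_classification (j δ)
  · exact absurd ⟨B, hB⟩ hδ
  refine ⟨A * B⁻¹, fun z => ?_⟩
  have h1 : j δ (j δ⁻¹ z) = z := by
    rw [← IsometryEquiv.mul_apply, ← map_mul, mul_inv_cancel, map_one]; rfl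
  rw [hB] at h1
  rw [map_mul, IsometryEquiv.mul_apply, hA, mul_smul, eq_inv_smul_iff.2 h1]

theorem IsMetricallyProper.restrict (hk : IsMetricallyProper k) (H : Subgroup Γ) :
    IsMetricallyProper (k.comp H.subtype) := fun z w R =>
  (hk z w R).preimage (f := fun h : H => (h : Γ)) Subtype.val_injective.injOn

/-- The subgroup has index at most 2: an element outside it is corrected by one fixed `δ`, which
moves the orbit point by a bounded amount. -/
theorem IsCobounded.restrict_orientationSubgroup (hk : IsCobounded k) (j : Γ →* (ℍ ≃ᵢ ℍ)) :
    IsCobounded (k.comp (orientationSubgroup j).subtype) := by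
  intro w
  obtain ⟨R, hR⟩ := hk w
  by_cases h : ∃ δ, δ ∉ orientationSubgroup j
  · obtain ⟨δ, hδ⟩ := h
    refine ⟨R + dist (k δ w) w, fun z => ?_⟩
    obtain ⟨γ, hγ⟩ := hR z
    by_cases hγ' : γ ∈ orientationSubgroup j
    · exact ⟨⟨γ, hγ'⟩, hγ.trans (by linarith [dist_nonneg (x := k δ w) (y := w)])⟩
    · refine ⟨⟨γ * δ⁻¹, mul_inv_mem_orientationSubgroup hγ' hδ⟩, ?_⟩
      change dist z (k (γ * δ⁻¹) w) ≤ _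
      have h1 : dist (k γ w) (k (γ * δ⁻¹) w) = dist (k δ w) w := by
        rw [← (k (γ * δ⁻¹)).dist_eq (k δ w), ← IsometryEquiv.mul_apply, ← map_mul,
          inv_mul_cancel_right]
      linarith [dist_triangle z (k γ w) (k (γ * δ⁻¹) w)]
  · push Not at h
    refine ⟨R, fun z => ?_⟩
    obtain ⟨γ, hγ⟩ := hR z
    exact ⟨⟨γ, h γ⟩, hγ⟩

theorem IsFuchsian.isCobounded (hj : IsFuchsian j) (hkS : ActsBySL k) (hk : IsMetricallyProper k)
    (hkc : IsCobounded k) : IsCobounded j := by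
  set H := orientationSubgroup j
  have h : IsCobounded (j.comp H.subtype) :=
    IsCobounded.of_proper (k := k.comp H.subtype) (fun γ => hkS γ) (hk.restrict H)
      (hkc.restrict_orientationSubgroup j) (fun γ => γ.2) (hj.isMetricallyProper.restrict H)
      (hj.faithful.comp Subtype.val_injective)
  intro w
  obtain ⟨R, hR⟩ := h w
  refine ⟨R, fun z => ?_⟩
  obtain ⟨γ, hγ⟩ := hR z
  exact ⟨γ, hγ⟩

end Fuchsian

end Parabolic

namespace Parabolic

open Real Filter Topology

/-! ### Barycentres -/

section Barycentre

variable {M : Type*} [MetricSpace M]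

/-- At the midpoint the energy drops by the factor `cosh (dist x y / 2)`, yet not below `I`. Thus
minimizing sequences are Cauchy. -/
theorem sq_dist_le_of_midpoint {E : M → ℝ} {e : ℝ}
    (hE : ∀ x y, ∃ m, 2 * cosh (dist x y / 2) * E m ≤ E x + E y) {I ε : ℝ} (hI : ∀ x, I ≤ E x)
    (heI : e ≤ I) (he0 : 0 < e) {x y : M} (hx : E x ≤ I + ε) (hy : E y ≤ I + ε) :
    e * dist x y ^ 2 / 8 ≤ ε := by
  obtain ⟨m, hm⟩ := hE x y
  have h1 := one_add_sq_half_le_cosh (dist x y / 2)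
  have h2 := hI m
  have hc := Real.one_le_cosh (dist x y / 2)
  have h3 : cosh (dist x y / 2) * I ≤ cosh (dist x y / 2) * E m := by gcongr
  have h4 : (1 + (dist x y / 2) ^ 2 / 2) * I ≤ cosh (dist x y / 2) * I := by
    gcongr
    exact he0.le.trans heI
  have h5 : e * ((dist x y / 2) ^ 2 / 2) ≤ I * ((dist x y / 2) ^ 2 / 2) := by gcongr
  linarith

theorem exists_minimizer [CompleteSpace M] [Nonempty M] {E : M → ℝ} {e : ℝ} (he0 : 0 < e)
    (he : ∀ x, e ≤ E x) (hcont : Continuous E)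
    (hE : ∀ x y, ∃ m, 2 * cosh (dist x y / 2) * E m ≤ E x + E y) : ∃ y, ∀ x, E y ≤ E x := by
  set I := ⨅ x, E x with hIdef
  have hbdd : BddBelow (Set.range E) := ⟨e, by rintro _ ⟨x, rfl⟩; exact he x⟩
  have hI : ∀ x, I ≤ E x := fun x => ciInf_le hbdd x
  have heI : e ≤ I := le_ciInf he
  have key : ∀ n : ℕ, ∃ y, E y < I + 1 / ((n : ℝ) + 1) := fun n =>
    exists_lt_of_ciInf_lt (lt_add_of_pos_right _ (by positivity))
  choose y hy using key
  have h0 : Tendsto (fun n : ℕ => 1 / ((n : ℝ) + 1)) atTop (𝓝 0) :=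
    tendsto_one_div_add_atTop_nhds_zero_nat
  have hanti : ∀ n m : ℕ, n ≤ m → 1 / ((m : ℝ) + 1) ≤ 1 / ((n : ℝ) + 1) := fun n m h => by
    gcongr
  have hcau : CauchySeq y := by
    refine cauchySeq_of_le_tendsto_0 (fun n : ℕ => √(8 * (1 / ((n : ℝ) + 1)) / e)) ?_ ?_
    · intro n m k hn hm
      apply Real.le_sqrt_of_sq_le
      have := sq_dist_le_of_midpoint hE hI heI he0 (ε := 1 / ((k : ℝ) + 1))
        ((hy n).le.trans (by linarith [hanti k n hn])) ((hy m).le.trans (by linarith [hanti k m hm]))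
      rw [le_div_iff₀ he0]
      linarith
    · have h1 := ((h0.const_mul 8).div_const e)
      have := (Real.continuous_sqrt.tendsto _).comp h1
      simpa [Function.comp_def] using this
  obtain ⟨z, hz⟩ := cauchySeq_tendsto_of_complete hcau
  refine ⟨z, fun x => le_trans ?_ (hI x)⟩
  have h1 := h0.const_add I
  rw [add_zero] at h1
  exact le_of_tendsto_of_tendsto' ((hcont.tendsto z).comp hz) h1 fun n => (hy n).le

theorem sq_dist_le_sub_of_minimizer {E : M → ℝ} {e : ℝ} (he0 : 0 < e) (he : ∀ x, e ≤ E x)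
    (hE : ∀ x y, ∃ m, 2 * cosh (dist x y / 2) * E m ≤ E x + E y) {y : M} (hy : ∀ x, E y ≤ E x)
    (x : M) : e * dist x y ^ 2 / 4 ≤ E x - E y := by
  obtain ⟨m, hm⟩ := hE x y
  have h1 := one_add_sq_half_le_cosh (dist x y / 2)
  have hc := Real.one_le_cosh (dist x y / 2)
  have h3 : cosh (dist x y / 2) * E y ≤ cosh (dist x y / 2) * E m := by gcongr; exact hy m
  have h4 : (1 + (dist x y / 2) ^ 2 / 2) * E y ≤ cosh (dist x y / 2) * E y := by
    gcongr
    exact he0.le.trans (he y)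
  have h5 : e * ((dist x y / 2) ^ 2 / 2) ≤ E y * ((dist x y / 2) ^ 2 / 2) := by
    gcongr
    exact he y
  linarith

theorem abs_cosh_sub_cosh_le {a b D : ℝ} (ha : 0 ≤ a) (hb : 0 ≤ b) (haD : a ≤ D) (hbD : b ≤ D) :
    |cosh a - cosh b| ≤ rexp D * |a - b| := by
  have := Convex.norm_image_sub_le_of_norm_deriv_le (f := cosh) (s := Set.Icc 0 D) (C := rexp D)
    (x := b) (y := a) (fun x _ => Real.differentiable_cosh.differentiableAt) (fun x hx => by
      rw [Real.deriv_cosh, Real.norm_eq_abs, abs_of_nonneg (Real.sinh_nonneg_iff.2 hx.1),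
        Real.sinh_eq]
      have h1 := Real.exp_le_exp.2 hx.2
      have h2 := Real.exp_pos (-x)
      have h3 := Real.exp_pos x
      linarith) (convex_Icc 0 D) ⟨hb, hbD⟩ ⟨ha, haD⟩
  simpa [Real.norm_eq_abs] using this

variable {Γ : Type*} [Group Γ] {j : Γ →* (ℍ ≃ᵢ ℍ)} {ρ : Γ →* (M ≃ᵢ M)}

/-- Weights on the orbit of `i`. -/
noncomputable def weight (j : Γ →* (ℍ ≃ᵢ ℍ)) (r : ℝ) (z : ℍ) (γ : Γ) : ℝ :=
  max 0 (r - dist z (j γ UpperHalfPlane.I))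

theorem weight_nonneg (r : ℝ) (z : ℍ) (γ : Γ) : 0 ≤ weight j r z γ := le_max_left _ _

theorem weight_le {r : ℝ} (hr : 0 ≤ r) (z : ℍ) (γ : Γ) : weight j r z γ ≤ r :=
  max_le hr (by linarith [dist_nonneg (x := z) (y := j γ UpperHalfPlane.I)])

theorem weight_eq_zero {r : ℝ} {z : ℍ} {γ : Γ} (h : r < dist z (j γ UpperHalfPlane.I)) :
    weight j r z γ = 0 := max_eq_left (by linarith)

theorem abs_weight_sub_le (r : ℝ) (z w : ℍ) (γ : Γ) :
    |weight j r z γ - weight j r w γ| ≤ dist z w := by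
  unfold weight
  rw [max_comm, max_comm 0]
  refine (abs_max_sub_max_le_abs _ _ _).trans ?_
  rw [sub_sub_sub_cancel_left, abs_sub_comm]
  exact abs_dist_sub_le z w _

theorem weight_mul (r : ℝ) (z : ℍ) (δ γ : Γ) : weight j r (j δ z) (δ * γ) = weight j r z γ := by
  unfold weight
  rw [map_mul, IsometryEquiv.mul_apply, (j δ).dist_eq]

/-- The functional whose minimum is a barycentre of an orbit. -/
noncomputable def energy (j : Γ →* (ℍ ≃ᵢ ℍ)) (ρ : Γ →* (M ≃ᵢ M)) (p : M) (r : ℝ) (z : ℍ) (y : M) :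
    ℝ := ∑ᶠ γ : Γ, weight j r z γ * cosh (dist y (ρ γ p))

theorem energy_eq_sum {p : M} {r : ℝ} {z : ℍ} {F : Finset Γ}
    (hF : ∀ γ, dist z (j γ UpperHalfPlane.I) ≤ r → γ ∈ F) (y : M) :
    energy j ρ p r z y = ∑ γ ∈ F, weight j r z γ * cosh (dist y (ρ γ p)) := by
  refine finsum_eq_sum_of_support_subset _ fun γ hγ => ?_
  by_contra h
  refine hγ ?_
  show weight j r z γ * cosh (dist y (ρ γ p)) = 0
  rw [weight_eq_zero (not_le.1 fun h' => h (hF γ h')), zero_mul]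

theorem exists_support (hj : IsMetricallyProper j) (z : ℍ) (r : ℝ) :
    ∃ F : Finset Γ, ∀ γ, dist z (j γ UpperHalfPlane.I) ≤ r → γ ∈ F :=
  ⟨(hj z UpperHalfPlane.I r).toFinset, fun γ hγ => by simpa using hγ⟩

theorem continuous_energy (hj : IsMetricallyProper j) (p : M) (r : ℝ) (z : ℍ) :
    Continuous (energy j ρ p r z) := by
  obtain ⟨F, hF⟩ := exists_support hj z r
  rw [show energy j ρ p r z = fun y => ∑ γ ∈ F, weight j r z γ * cosh (dist y (ρ γ p)) from
    funext fun y => energy_eq_sum hF y]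
  refine continuous_finsetSum _ fun γ _ => continuous_const.mul (Real.continuous_cosh.comp ?_)
  fun_prop

theorem le_energy (hj : IsMetricallyProper j) (p : M) {r : ℝ} {z : ℍ} (y : M) {γ : Γ}
    (hγ : 1 ≤ weight j r z γ) : cosh (dist y (ρ γ p)) ≤ energy j ρ p r z y := by
  obtain ⟨F, hF⟩ := exists_support hj z r
  rw [energy_eq_sum hF]
  have hmem : γ ∈ F := by
    by_contra h
    have := weight_eq_zero (not_le.1 fun h' => h (hF γ h'))
    linarith
  have hcosh := fun δ => Real.one_le_cosh (dist y (ρ δ p))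
  calc cosh (dist y (ρ γ p)) ≤ weight j r z γ * cosh (dist y (ρ γ p)) := by
        nlinarith [hcosh γ]
    _ ≤ _ := Finset.single_le_sum (f := fun δ => weight j r z δ * cosh (dist y (ρ δ p)))
        (fun δ _ => mul_nonneg (weight_nonneg _ _ _) (by linarith [hcosh δ])) hmem

theorem energy_midpoint (hM : IsCATNegOne M) (hj : IsMetricallyProper j) (p : M) (r : ℝ) (z : ℍ)
    (x y : M) : ∃ m, 2 * cosh (dist x y / 2) * energy j ρ p r z m ≤
      energy j ρ p r z x + energy j ρ p r z y := by
  obtain ⟨F, hF⟩ := exists_support hj z r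
  obtain ⟨m, hm⟩ := hM.exists_midpoint x y
  refine ⟨m, ?_⟩
  rw [energy_eq_sum hF, energy_eq_sum hF, energy_eq_sum hF, Finset.mul_sum, ← Finset.sum_add_distrib]
  refine Finset.sum_le_sum fun γ _ => ?_
  have h1 := hm (ρ γ p)
  rw [dist_comm (ρ γ p) m, dist_comm (ρ γ p) x, dist_comm (ρ γ p) y] at h1
  have := mul_le_mul_of_nonneg_left h1 (weight_nonneg (j := j) r z γ)
  linarith

theorem energy_equivariant (p : M) (r : ℝ) (z : ℍ) (y : M) (δ : Γ) :
    energy j ρ p r (j δ z) (ρ δ y) = energy j ρ p r z y := by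
  unfold energy
  rw [← finsum_comp_equiv (Equiv.mulLeft δ)]
  refine finsum_congr fun γ => ?_
  rw [Equiv.coe_mulLeft, weight_mul, map_mul, IsometryEquiv.mul_apply, (ρ δ).dist_eq]

/-- There are equivariant Lipschitz maps. -/
theorem exists_equivariant_map [CompleteSpace M] (hM : IsCATNegOne M) (p : M)
    (hj : IsMetricallyProper j) (hjc : IsCobounded j) :
    ∃ (f : ℍ → M) (K : ℝ), 1 ≤ K ∧ IsEquivariant j ρ f ∧
      ∀ z w, dist (f z) (f w) ≤ K * dist z w := by
  obtain ⟨R, hR⟩ := hjc UpperHalfPlane.I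
  have hR0 : 0 ≤ R := dist_nonneg.trans (hR UpperHalfPlane.I).choose_spec
  set r := R + 1 with hr
  have : Nonempty M := ⟨p⟩
  have hw : ∀ z, ∃ γ, 1 ≤ weight j r z γ := fun z => by
    obtain ⟨γ, hγ⟩ := hR z
    exact ⟨γ, le_max_of_le_right (by linarith)⟩
  have he : ∀ z y, 1 ≤ energy j ρ p r z y := fun z y => by
    obtain ⟨γ, hγ⟩ := hw z
    exact (Real.one_le_cosh _).trans (le_energy hj p y hγ)
  have hmid := energy_midpoint (ρ := ρ) hM hj p r
  choose f hf using fun z => exists_minimizer one_pos (he z) (continuous_energy hj p r z) (hmid z)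
  have hquant := fun z x => sq_dist_le_sub_of_minimizer one_pos (he z) (hmid z) (hf z) x
  have heq : IsEquivariant j ρ f := by
    intro γ z
    have h1 := hquant (j γ z) (ρ γ (f z))
    have h2 := hf z ((ρ γ)⁻¹ (f (j γ z)))
    rw [← energy_equivariant p r z _ γ, ← energy_equivariant p r z _ γ,
      IsometryEquiv.apply_inv_self] at h2
    have h3 : dist (ρ γ (f z)) (f (j γ z)) ^ 2 ≤ 0 := by linarith
    have h4 : dist (ρ γ (f z)) (f (j γ z)) = 0 := by
      have := sq_nonneg (dist (ρ γ (f z)) (f (j γ z)))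
      exact pow_eq_zero_iff (two_ne_zero) |>.1 (le_antisymm h3 this)
    exact (dist_eq_zero.1 h4).symm
  -- One finite set carries the weights of all `z` within `R + 1` of `i`: a fundamental ball of
  -- radius `R`, enlarged by the scale 1 of the local estimate.
  obtain ⟨F, hF⟩ := exists_support hj UpperHalfPlane.I (r + (R + 1))
  set C₁ := ∑ γ ∈ F, r * cosh (dist p (ρ γ p)) with hC₁
  set C₂ := ∑ γ ∈ F, dist p (ρ γ p) with hC₂
  set D := C₁ + 2 * C₂ with hD
  have hball : ∀ z, dist z UpperHalfPlane.I ≤ R + 1 →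
      (∀ γ, dist z (j γ UpperHalfPlane.I) ≤ r → γ ∈ F) := fun z hz γ hγ =>
    hF γ (by linarith [dist_triangle_left UpperHalfPlane.I (j γ UpperHalfPlane.I) z])
  have hbound : ∀ z, dist z UpperHalfPlane.I ≤ R + 1 → ∀ γ ∈ F, dist (f z) (ρ γ p) ≤ D := by
    intro z hz γ hγ
    obtain ⟨γ₀, hγ₀⟩ := hw z
    have hγ₀F : γ₀ ∈ F := by
      by_contra h
      have := weight_eq_zero (not_le.1 fun h' => h (hball z hz γ₀ h'))
      linarith
    have h1 : dist (f z) (ρ γ₀ p) ≤ C₁ := by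
      calc dist (f z) (ρ γ₀ p) ≤ cosh (dist (f z) (ρ γ₀ p)) :=
            (Real.self_le_sinh_iff.2 dist_nonneg).trans (Real.sinh_lt_cosh _).le
        _ ≤ energy j ρ p r z (f z) := le_energy hj p _ hγ₀
        _ ≤ energy j ρ p r z p := hf z p
        _ ≤ C₁ := by
          rw [energy_eq_sum (hball z hz)]
          refine Finset.sum_le_sum fun γ _ => ?_
          have := Real.cosh_pos (dist p (ρ γ p))
          gcongr
          exact weight_le (by linarith) z γ
    have h2 : ∀ δ ∈ F, dist p (ρ δ p) ≤ C₂ := fun δ hδ =>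
      Finset.single_le_sum (f := fun δ => dist p (ρ δ p)) (fun _ _ => dist_nonneg) hδ
    linarith [dist_triangle (f z) (ρ γ₀ p) (ρ γ p), dist_triangle_left (ρ γ₀ p) (ρ γ p) p,
      h2 γ hγ, h2 γ₀ hγ₀F]
  set K := 2 * (F.card * rexp D) + 1 with hK
  have hloc : ∀ z w, dist z UpperHalfPlane.I ≤ R → dist z w ≤ 1 →
      dist (f z) (f w) ≤ K * dist z w := by
    intro z w hz hzw
    have hz' : dist z UpperHalfPlane.I ≤ R + 1 := by linarith
    have hw' : dist w UpperHalfPlane.I ≤ R + 1 := by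
      linarith [dist_triangle_left w UpperHalfPlane.I z]
    have h1 := hquant z (f w)
    have h2 := hquant w (f z)
    rw [dist_comm] at h1
    rw [energy_eq_sum (hball z hz'), energy_eq_sum (hball z hz')] at h1
    rw [energy_eq_sum (hball w hw'), energy_eq_sum (hball w hw')] at h2
    -- Adding the quadratic growth at both minimizers bounds `dist (f z) (f w) ^ 2 / 2` by this sum.
    -- Each term is a product of a weight difference and a `cosh` difference, so one factor `dist (f
    -- z) (f w)` cancels.
    have h3 : (∑ γ ∈ F, weight j r z γ * cosh (dist (f w) (ρ γ p)) -
        ∑ γ ∈ F, weight j r z γ * cosh (dist (f z) (ρ γ p))) +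
        (∑ γ ∈ F, weight j r w γ * cosh (dist (f z) (ρ γ p)) -
        ∑ γ ∈ F, weight j r w γ * cosh (dist (f w) (ρ γ p))) ≤
        ∑ γ ∈ F, dist z w * (rexp D * dist (f z) (f w)) := by
      rw [← Finset.sum_sub_distrib, ← Finset.sum_sub_distrib, ← Finset.sum_add_distrib]
      refine Finset.sum_le_sum fun γ hγ => ?_
      have h4 := abs_weight_sub_le (j := j) r z w γ
      have h5 := abs_cosh_sub_cosh_le (dist_nonneg (x := f w) (y := ρ γ p))
        (dist_nonneg (x := f z) (y := ρ γ p)) (hbound w hw' γ hγ) (hbound z hz' γ hγ)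
      have h6 : |dist (f w) (ρ γ p) - dist (f z) (ρ γ p)| ≤ dist (f z) (f w) := by
        rw [dist_comm (f z) (f w)]; exact abs_dist_sub_le (f w) (f z) (ρ γ p)
      calc _ = (weight j r z γ - weight j r w γ) *
            (cosh (dist (f w) (ρ γ p)) - cosh (dist (f z) (ρ γ p))) := by ring
        _ ≤ |weight j r z γ - weight j r w γ| *
            |cosh (dist (f w) (ρ γ p)) - cosh (dist (f z) (ρ γ p))| := by
          rw [← abs_mul]; exact le_abs_self _
        _ ≤ dist z w * (rexp D * dist (f z) (f w)) := by
          gcongr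
          exact h5.trans (by gcongr)
    rw [Finset.sum_const, nsmul_eq_mul] at h3
    rcases (dist_nonneg (x := f z) (y := f w)).eq_or_lt with h0 | h0
    · rw [← h0]; positivity
    · have h7 : dist (f z) (f w) * dist (f z) (f w) ≤
          dist (f z) (f w) * (2 * (F.card * rexp D) * dist z w) := by linarith
      have h8 := le_of_mul_le_mul_left h7 h0
      rw [hK]
      linarith [dist_nonneg (x := z) (y := w)]
  refine ⟨f, K, by rw [hK]; linarith [show 0 ≤ 2 * (F.card * rexp D) by positivity], heq,
    dist_le_of_local one_pos fun z w hzw => ?_⟩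
  obtain ⟨γ, hγ⟩ := hR z
  have h1 := hloc ((j γ)⁻¹ z) ((j γ)⁻¹ w) (by
    rw [← (j γ).dist_eq, IsometryEquiv.apply_inv_self]; exact hγ) (by rw [IsometryEquiv.dist_eq]; exact hzw)
  have h2 : ∀ u, f u = ρ γ (f ((j γ)⁻¹ u)) := fun u => by
    rw [← heq γ, IsometryEquiv.apply_inv_self]
  rw [IsometryEquiv.dist_eq] at h1
  rw [h2 z, h2 w, (ρ γ).dist_eq]
  exact h1

end Barycentre

end Parabolic

namespace Parabolic

open Real Filter Topology

/-! ### Comparison of the minimal Lipschitz constants -/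

section Comparison

theorem cosh_sub_one_le_sq {x : ℝ} (hx : |x| ≤ 1) : cosh x - 1 ≤ x ^ 2 := by
  have h1 := Real.cosh_le_exp_half_sq x
  have hx2 : x ^ 2 ≤ 1 := by rw [← sq_abs]; exact pow_le_one₀ (abs_nonneg x) hx
  have h2 := Real.abs_exp_sub_one_le (x := x ^ 2 / 2) (by
    rw [abs_of_nonneg (by positivity)]; linarith)
  rw [abs_of_nonneg (a := x ^ 2 / 2) (by positivity)] at h2
  linarith [le_abs_self (rexp (x ^ 2 / 2) - 1)]

theorem cosh_add_sq_half_le {a b : ℝ} (ha : 0 ≤ a) (hb : 0 ≤ b) :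
    cosh a + b ^ 2 / 2 ≤ cosh (a + b) := by
  rw [Real.cosh_add]
  have h1 := one_add_sq_half_le_cosh b
  have h2 := Real.one_le_cosh a
  have h3 := mul_nonneg (Real.sinh_nonneg_iff.2 ha) (Real.sinh_nonneg_iff.2 hb)
  nlinarith [sq_nonneg b]

theorem exp_neg_mul_sq_le {K ε : ℝ} (hε : 0 < ε) :
    rexp (-(2 * (K ^ 2 / ε ^ 2))) * K ^ 2 ≤ ε ^ 2 / 2 := by
  have h1 := Real.add_one_le_exp (2 * (K ^ 2 / ε ^ 2))
  have h2 := Real.exp_pos (2 * (K ^ 2 / ε ^ 2))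
  have h3 : K ^ 2 = K ^ 2 / ε ^ 2 * ε ^ 2 := by field_simp
  rw [Real.exp_neg, inv_mul_le_iff₀ h2]
  nlinarith [sq_pos_of_pos hε]

/-- Two homomorphisms to `ℝ` with the same absolute value agree up to sign. -/
theorem eq_or_eq_neg_of_abs_eq {G : Type*} [Group G] {a b : G → ℝ}
    (ha : ∀ x y, a (x * y) = a x + a y) (hb : ∀ x y, b (x * y) = b x + b y)
    (h : ∀ x, |a x| = |b x|) : (∀ x, a x = b x) ∨ ∀ x, a x = -b x := by
  by_contra! hne
  obtain ⟨⟨x, hx⟩, y, hy⟩ := hne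
  have hx' := (abs_eq_abs.1 (h x)).resolve_left hx
  have hy' := (abs_eq_abs.1 (h y)).resolve_right hy
  -- A group is not the union of two proper subgroups: `x * y` lies in neither the kernel of `a - b`
  -- nor that of `a + b`.
  rcases abs_eq_abs.1 (h (x * y)) with hxy | hxy <;> rw [ha, hb, hx', hy'] at hxy
  · exact hx (by linarith)
  · exact hy (by linarith)

variable {M : Type*} [MetricSpace M] {Γ : Type*} [Group Γ] {j : Γ →* (ℍ ≃ᵢ ℍ)} {ρ : Γ →* (M ≃ᵢ M)}
  {c : GeodesicRay M} {μ : Γ → ℝ}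

/-- Pushing an equivariant map far towards the fixed point at infinity makes its Lipschitz constant
close to that of a prescribed equivariant function. -/
theorem exists_equivariant_of_function [CompleteSpace M] (hM : IsCATNegOne M)
    (hj : IsMetricallyProper j) (hjc : IsCobounded j)
    (hB : ∀ γ x, busemann c (ρ γ x) = busemann c x + μ γ) {f : ℍ → ℝ} {K : ℝ} (hK : 0 ≤ K)
    (hf : ∀ γ z, f (j γ z) = f z + μ γ) (hfK : ∀ z w, dist (f z) (f w) ≤ K * dist z w)
    {ε : ℝ} (hε : 0 < ε) :
    ∃ F : ℍ → M, IsEquivariant j ρ F ∧ ∀ z w, dist (F z) (F w) ≤ (K + ε) * dist z w := by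
  obtain ⟨f₀, K₀, hK₀, heq, hlip⟩ := exists_equivariant_map (ρ := ρ) hM (c.1 0) hj hjc
  obtain ⟨R, hR⟩ := hjc UpperHalfPlane.I
  have hK₀' : 0 < K₀ := by linarith
  set u : ℍ → ℝ := fun z => busemann c (f₀ z) - f z with hu
  have hinv : ∀ γ z, u (j γ z) = u z := fun γ z => by simp only [hu]; rw [heq, hB, hf]; ring
  have hulip : ∀ z w, |u z - u w| ≤ (K₀ + K) * dist z w := fun z w => by
    have h1 := (dist_busemann_le c (f₀ z) (f₀ w)).trans (hlip z w)
    have h2 := hfK z w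
    rw [Real.dist_eq] at h1 h2
    rw [show u z - u w = (busemann c (f₀ z) - busemann c (f₀ w)) - (f z - f w) by
      simp only [hu]; ring]
    linarith [abs_sub (busemann c (f₀ z) - busemann c (f₀ w)) (f z - f w)]
  set C := |u UpperHalfPlane.I| + (K₀ + K) * R
  have hC : ∀ z, -C ≤ u z := fun z => by
    obtain ⟨γ, hγ⟩ := hR z
    have h1 := hulip z (j γ UpperHalfPlane.I)
    rw [hinv] at h1
    have h2 : (K₀ + K) * dist z (j γ UpperHalfPlane.I) ≤ (K₀ + K) * R := by gcongr
    linarith [neg_abs_le (u z - u UpperHalfPlane.I), neg_abs_le (u UpperHalfPlane.I)]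
  -- Every point is pushed at least `τ`, so the horospherical part is at most `e^{-2τ} K₀² d² ≤ ε²
  -- d² / 2`. This is below the gap between `cosh (K d)` and `cosh ((K + ε) d)`.
  set τ := K₀ ^ 2 / ε ^ 2 with hτ
  have hτ0 : 0 ≤ τ := by positivity
  have htime : ∀ z, τ ≤ u z + (C + τ) := fun z => by linarith [hC z]
  choose F hF _ using fun z => exists_isPush hM c (f₀ z) (hτ0.trans (htime z))
  have hBF : ∀ z, busemann c (F z) = f z - (C + τ) := fun z => by
    rw [(hF z).busemann_eq]; simp only [hu]; ring
  -- Equivariance follows from uniqueness of pushes, the pushing time being invariant. At scale `1 /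
  -- K₀` one has `K₀ d ≤ 1`, where `cosh x - 1 ≤ x ^ 2`.
  refine ⟨F, fun γ z => ?_, dist_le_of_local (δ := 1 / K₀) (by positivity) fun z w hzw => ?_⟩
  · have h1 := hF (j γ z)
    rw [heq, hinv] at h1
    exact h1.unique hM ((hF z).map (ρ γ) (hB γ))
  · set d := dist z w
    have hd : 0 ≤ d := dist_nonneg
    have hK₀d : K₀ * d ≤ 1 := by rwa [le_div_iff₀ hK₀', mul_comm] at hzw
    have h1 := (hF z).contraction hM (hF w)
    rw [hBF, hBF, sub_sub_sub_cancel_right] at h1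
    have h2 : cosh (f z - f w) ≤ cosh (K * d) := by
      rw [Real.cosh_le_cosh, abs_of_nonneg (mul_nonneg hK hd)]
      exact hfK z w
    have h3 : cosh (dist (f₀ z) (f₀ w)) ≤ cosh (K₀ * d) := by
      rw [Real.cosh_le_cosh, abs_of_nonneg dist_nonneg, abs_of_nonneg (by positivity)]
      exact hlip z w
    have h4 := cosh_sub_one_le_sq (x := K₀ * d) (by rwa [abs_of_nonneg (by positivity)])
    have h5 : rexp (-((u z + (C + τ)) + (u w + (C + τ)))) *
        (cosh (dist (f₀ z) (f₀ w)) - cosh (busemann c (f₀ z) - busemann c (f₀ w))) ≤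
        rexp (-(2 * τ)) * (K₀ * d) ^ 2 := by
      refine (mul_le_mul_of_nonneg_left ?_ (Real.exp_pos _).le).trans
        (mul_le_mul_of_nonneg_right (Real.exp_le_exp.2 ?_) (sq_nonneg _))
      · linarith [Real.one_le_cosh (busemann c (f₀ z) - busemann c (f₀ w))]
      · linarith [htime z, htime w]
    have h6 := mul_le_mul_of_nonneg_right (exp_neg_mul_sq_le (K := K₀) hε) (sq_nonneg d)
    have h7 := cosh_add_sq_half_le (mul_nonneg hK hd) (mul_nonneg hε.le hd)
    have h8 : cosh (dist (F z) (F w)) ≤ cosh ((K + ε) * d) := by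
      rw [add_mul]
      rw [mul_pow] at h5 h7
      rw [← hτ] at h6
      linarith
    rwa [Real.cosh_le_cosh, abs_of_nonneg dist_nonneg, abs_of_nonneg (by positivity)] at h8

theorem minLip_ne_top [CompleteSpace M] (hM : IsCATNegOne M) (p : M)
    (hj : IsMetricallyProper j) (hjc : IsCobounded j) : minLip j ρ ≠ ⊤ := by
  obtain ⟨f, K, hK, heq, hlip⟩ := exists_equivariant_map (ρ := ρ) hM p hj hjc
  exact ne_top_of_le_ne_top ENNReal.coe_ne_top (iInf₂_le K.toNNReal ⟨f, heq,
    LipschitzWith.of_dist_le_mul fun z w => by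
      rw [Real.coe_toNNReal _ (by linarith)]; exact hlip z w⟩)

theorem isEquivariant_translationRep {m : Γ →* Multiplicative ℝ} {f : ℍ → ℝ} :
    IsEquivariant j (translationRep m) f ↔ ∀ γ z, f (j γ z) = f z + (m γ).toAdd := by
  refine forall₂_congr fun γ z => ?_
  rw [add_comm]
  rfl

/-- Equivariant Lipschitz functions do not see the sign of the translation morphism. -/
theorem exists_function_iff {m : Γ →* Multiplicative ℝ}
    (hμ : (∀ γ, μ γ = (m γ).toAdd) ∨ ∀ γ, μ γ = -(m γ).toAdd) {K : ℝ≥0} :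
    (∃ f : ℍ → ℝ, IsEquivariant j (translationRep m) f ∧ LipschitzWith K f) ↔
      ∃ f : ℍ → ℝ, (∀ γ z, f (j γ z) = f z + μ γ) ∧ LipschitzWith K f := by
  simp only [isEquivariant_translationRep]
  rcases hμ with hμ | hμ
  · simp only [hμ]
  · constructor
    · rintro ⟨f, hf, hK⟩
      exact ⟨fun z => -f z, fun γ z => by simp only [hf, hμ]; ring, hK.neg⟩
    · rintro ⟨f, hf, hK⟩
      exact ⟨fun z => -f z, fun γ z => by simp only [hf, hμ]; ring, hK.neg⟩

theorem minLip_eq [CompleteSpace M] (hM : IsCATNegOne M)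
    (hj : IsMetricallyProper j) (hjc : IsCobounded j)
    (hB : ∀ γ x, busemann c (ρ γ x) = busemann c x + μ γ) {m : Γ →* Multiplicative ℝ}
    (hμ : (∀ γ, μ γ = (m γ).toAdd) ∨ ∀ γ, μ γ = -(m γ).toAdd) :
    minLip j ρ = minLip j (translationRep m) := by
  apply le_antisymm
  · refine le_iInf₂ fun K hK => ENNReal.le_of_forall_pos_le_add fun ε hε _ => ?_
    obtain ⟨f, hf, hfK⟩ := (exists_function_iff hμ).1 hK
    obtain ⟨F, hF, hFK⟩ := exists_equivariant_of_function hM hj hjc hB K.2 hf hfK.dist_le_mul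
      (NNReal.coe_pos.2 hε)
    rw [← ENNReal.coe_add]
    exact iInf₂_le (K + ε) ⟨F, hF, LipschitzWith.of_dist_le_mul hFK⟩
  · refine le_iInf₂ fun K hK => ?_
    obtain ⟨F, hF, hFK⟩ := hK
    refine iInf₂_le K ((exists_function_iff hμ).2 ⟨fun z => busemann c (F z), fun γ z => ?_,
      LipschitzWith.of_dist_le_mul fun z w => ?_⟩)
    · simp only [hF γ z, hB]
    · exact (dist_busemann_le c _ _).trans (hFK.dist_le_mul z w)

end Comparison

end Parabolic

theorem lemmal {S : Type*} [TopologicalSpace S] (hS : Parabolic.IsClosedHyperbolicSurface S)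
    (x₀ : S) {M : Type*} [MetricSpace M] [CompleteSpace M] (hM : Parabolic.IsCATNegOne M)
    (j : FundamentalGroup S x₀ →* (ℍ ≃ᵢ ℍ)) (hj : Parabolic.IsFuchsian j)
    (ρ : FundamentalGroup S x₀ →* (M ≃ᵢ M)) (hρ : Parabolic.IsParabolic ρ)
    (m : FundamentalGroup S x₀ →* Multiplicative ℝ)
    (hm : ∀ γ : FundamentalGroup S x₀,
      Parabolic.translationLength (ρ γ) = |(m γ).toAdd|) :
    Parabolic.minLip j ρ ≠ ⊤ ∧
      Parabolic.minLip j ρ = Parabolic.minLip j (Parabolic.translationRep m) := by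
  obtain ⟨k, hkS, hk, hkc⟩ := Parabolic.exists_cobounded_action hS x₀
  have hjp := hj.isMetricallyProper
  have hjc := hj.isCobounded hkS hk hkc
  obtain ⟨ξ, hξ⟩ := hρ
  obtain ⟨c, rfl⟩ := Quotient.exists_rep ξ
  have hB := fun γ => Parabolic.busemann_isometry hM c (ρ γ) (hξ γ)
  refine ⟨Parabolic.minLip_ne_top hM (c.1 0) hjp hjc, Parabolic.minLip_eq hM hjp hjc hB ?_⟩
  -- Here `μ γ` is the Busemann value of `ρ γ (c 0)`; it is additive by `hB`, and both `|μ γ|` and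
  -- `|m γ|` are the translation length.
  refine Parabolic.eq_or_eq_neg_of_abs_eq (b := fun γ => (m γ).toAdd) (fun γ δ => ?_)
    (fun γ δ => by rw [map_mul, toAdd_mul]) fun γ => ?_
  · rw [map_mul, IsometryEquiv.mul_apply, hB γ, add_comm]
  · rw [← hm γ, Parabolic.translationLength_eq hM (ρ γ) (hB γ)]
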